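/- Let $n\ge 2$, $s\in\mathbb R$, $t>-n/2$. For a Schwartz vector field $f=(f_1,\dots,f_n)\in\mathcal S(\mathbb R^n;\mathbb C^n)$ put $$\|f\|^2_{H^s_t(\mathbb R^n;\mathbb C^n)}=\sum_{i=1}^n\int_{\mathbb R^n}|y|^{2t}(1+|y|^2)^{s-t}|\widehat f_i(y)|^2\,dy,\qquad \widehat{f_i}(y)=(2\pi)^{-n/2}\int_{\mathbb R^n}e^{-i\langle y,x\rangle}f_i(x)\,dx,$$ and let $H^s_t(\mathbb R^n;\mathbb C^n)$ be the completion of $\mathcal S(\mathbb R^n;\mathbb C^n)$ with respect to this norm. On $T\mathbb S^{n-1}=\{(x,\xi)\in\mathbb R^n\times\mathbb R^n: |\xi|=1,\ \langle x,\xi\rangle=0\}$ define the momentum ray transforms $(I^kf)(x,\xi)=\int_{\mathbb R}\tau^k\langle f(x+\tau\xi),\xi\rangle\,d\tau$ $(k=0,1)$, where $\langle f,\xi\rangle=\sum_i f_i\xi_i$, the Fourier transform $$\widehat\varphi(y,\xi)=(2\pi)^{-(n-1)/2}\int_{\xi^\perp}e^{-i\langle y,x\rangle}\varphi(x,\xi)\,dx,$$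 the norms $$\|\varphi\|^2_{H^{s'}_{t'}}=\frac1{2\pi}\int_{\mathbb S^{n-1}}\int_{\xi^\perp}|y|^{2t'}(1+|y|^2)^{s'-t'}|\widehat\varphi(y,\xi)|^2\,dy\,d\xi ,$$ and let $\Xi_i$ be the restriction to $T\mathbb S^{n-1}$ of the vector field $\frac{\partial}{\partial\xi_i}-\sum_p x_i\xi_p\frac{\partial}{\partial x_p}-\sum_p\xi_i\xi_p\frac{\partial}{\partial\xi_p}$, which is tangent to $T\mathbb S^{n-1}$ at its points. Let $a_n=\dfrac{\Gamma((n-1)/2)}{2\pi^{(n-1)/2}}$. Then $$\|f\|^2_{H^s_t(\mathbb R^n;\mathbb C^n)}\le 2a_n\Big(\sum_{i=1}^n\|\Xi_i(I^0f)\|^2_{H^{s+1/2}_{t+1/2}}+\|I^0f\|^2_{H^{s+1/2}_{t+1/2}}+\|I^1f\|^2_{H^{s+3/2}_{t+3/2}}\Big)$$ for all $f\in\mathcal S(\mathbb R^n;\mathbb C^n)$ and, more generally, for all $f\in H^s_t(\mathbb R^n;\mathbb C^n)$. In the general case, the Fourier transforms of $I^0f$, $I^1f$ and $\Xi_i(I^0f)$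 are defined by continuity, as distributions on $\{(y,\xi)\in T\mathbb S^{n-1}:y\ne0\}$, from the Schwartz fields (that is, as the limits of the pairings with smooth compactly supported test functions when Schwartz fields tend to $f$ in $H^s_t(\mathbb R^n;\mathbb C^n)$), and the squared norm on the right-hand side is the integral above if the distribution is a measurable function, and $+\infty$ if it is not. -/

import Mathlib

open MeasureTheory Filter Topology
open scoped FourierTransform SchwartzMap ENNReal InnerProductSpace ContDiff

noncomputable section

namespace MomentumRay

/-- Euclidean space `ℝⁿ`. -/
abbrev E (n : ℕ) := EuclideanSpace ℝ (Fin n)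

/-- The weight `|y|^{2t} (1 + |y|²)^{s-t}`. -/
def weight {n : ℕ} (s t : ℝ) (y : E n) : ℝ :=
  ‖y‖ ^ (2 * t) * (1 + ‖y‖ ^ 2) ^ (s - t)

/-- The Fourier transform `(2π)^{-n/2} ∫ e^{-i⟨y,x⟩} φ(x) dx` on `ℝⁿ`. -/
def fourierE {n : ℕ} (φ : E n → ℂ) (y : E n) : ℂ :=
  (((2 * Real.pi) ^ (-(n : ℝ) / 2) : ℝ) : ℂ) *
    ∫ x : E n, Complex.exp (-(Complex.I * ((⟪y, x⟫_ℝ : ℝ) : ℂ))) * φ x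

/-! ### The space of vector fields -/

/-- Complex vector fields on `ℝⁿ` with components in the Schwartz space. The parameters `s`, `t`
only serve to attach the `H^s_t` norm to this space. -/
def SchwartzField (n : ℕ) (_s t : ℝ) (_ht : -(n : ℝ) / 2 < t) : Type :=
  Fin n → 𝓢(E n, ℂ)

/-- The components of a Schwartz vector field. -/
def SchwartzField.comp {n : ℕ} {s t : ℝ} {ht : -(n : ℝ) / 2 < t} (f : SchwartzField n s t ht) :
    Fin n → 𝓢(E n, ℂ) := f

instance (n : ℕ) (s t : ℝ) (ht : -(n : ℝ) / 2 < t) : AddCommGroup (SchwartzField n s t ht) :=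
  inferInstanceAs (AddCommGroup (Fin n → 𝓢(E n, ℂ)))

/-- The squared norm `‖f‖²_{H^s_t} = ∑ᵢ ∫ |y|^{2t} (1 + |y|²)^{s-t} |f̂ᵢ(y)|² dy`. -/
def sobolevSq {n : ℕ} (s t : ℝ) (f : Fin n → 𝓢(E n, ℂ)) : ℝ :=
  ∑ i, ∫ y : E n, weight s t y * ‖fourierE (f i) y‖ ^ 2

lemma weight_nonneg {n : ℕ} (s t : ℝ) (y : E n) : 0 ≤ weight s t y := by
  unfold weight; positivity

lemma weight_measurable {n : ℕ} (s t : ℝ) : Measurable (weight (n := n) s t) := by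
  unfold weight; fun_prop

lemma radial_integrable (n : ℕ) (hn : 1 ≤ n) (t K : ℝ) (ht : -(n : ℝ) / 2 < t) (_hK : 0 ≤ K)
    (hK2 : n + 2 * t < 2 * K) :
    Integrable (fun y : E n => ‖y‖ ^ (2 * t) * (1 + ‖y‖ ^ 2) ^ (-K)) := by
  have : Nonempty (Fin n) := ⟨⟨0, hn⟩⟩
  have : Nontrivial (E n) := inferInstance
  have key := integrable_fun_norm_addHaar (volume : Measure (E n))
    (f := fun r : ℝ => r ^ (2 * t) * (1 + r ^ 2) ^ (-K))
  refine key.2 ?_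
  simp only [finrank_euclideanSpace, Fintype.card_fin, smul_eq_mul]
  have hpow : ∀ r : ℝ, 0 < r → r ^ (n - 1) * r ^ (2 * t) = r ^ ((n : ℝ) - 1 + 2 * t) := by
    intro r hr
    rw [Real.rpow_add hr, ← Real.rpow_natCast, Nat.cast_sub hn, Nat.cast_one]
  have hmeas : ∀ μ : Measure ℝ, AEStronglyMeasurable
      (fun r : ℝ => r ^ (n - 1) * (r ^ (2 * t) * (1 + r ^ 2) ^ (-K))) μ := by
    intro μ
    exact (by fun_prop : Measurable
      (fun r : ℝ => r ^ (n - 1) * (r ^ (2 * t) * (1 + r ^ 2) ^ (-K)))).aestronglyMeasurable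
  rw [← Set.Ioc_union_Ioi_eq_Ioi (zero_le_one : (0 : ℝ) ≤ 1)]
  refine IntegrableOn.union ?_ ?_
  · have h1 : IntegrableOn (fun r : ℝ => r ^ ((n : ℝ) - 1 + 2 * t)) (Set.Ioc 0 1) := by
      rw [← intervalIntegrable_iff_integrableOn_Ioc_of_le zero_le_one]
      exact intervalIntegral.intervalIntegrable_rpow' (by linarith)
    refine Integrable.mono' h1 (hmeas _) ?_
    refine (ae_restrict_iff' measurableSet_Ioc).2 (Eventually.of_forall fun r hr => ?_)
    have hr0 : 0 < r := hr.1
    rw [Real.norm_of_nonneg (by positivity), ← mul_assoc, hpow r hr0]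
    refine mul_le_of_le_one_right (by positivity) ?_
    exact Real.rpow_le_one_of_one_le_of_nonpos (by nlinarith) (by linarith)
  · have h1 : IntegrableOn (fun r : ℝ => r ^ ((n : ℝ) - 1 + 2 * t - 2 * K)) (Set.Ioi 1) :=
      integrableOn_Ioi_rpow_of_lt (by linarith) zero_lt_one
    refine Integrable.mono' h1 (hmeas _) ?_
    refine (ae_restrict_iff' measurableSet_Ioi).2 (Eventually.of_forall fun r hr => ?_)
    have hr0 : 0 < r := lt_trans zero_lt_one hr
    rw [Real.norm_of_nonneg (by positivity), ← mul_assoc, hpow r hr0,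
      sub_eq_add_neg _ (2 * K), Real.rpow_add hr0 _ (-(2 * K))]
    refine mul_le_mul_of_nonneg_left ?_ (Real.rpow_nonneg hr0.le _)
    have h2 : r ^ (-(2 * K)) = (r ^ 2) ^ (-K) := by
      rw [← Real.rpow_natCast r 2, ← Real.rpow_mul hr0.le]; congr 1; push_cast; ring
    rw [h2]
    exact Real.rpow_le_rpow_of_nonpos (pow_pos hr0 2) (by linarith) (by linarith)

/-- The Fourier transform of a Schwartz function is a Schwartz function. -/
lemma fourierE_schwartz {n : ℕ} (φ : 𝓢(E n, ℂ)) : ∃ ψ : 𝓢(E n, ℂ), ∀ y, fourierE φ y = ψ y := by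
  have h2 : (2 * Real.pi)⁻¹ ≠ 0 := by positivity
  let L : E n ≃L[ℝ] E n := ContinuousLinearEquiv.smulLeft (Units.mk0 ((2 * Real.pi)⁻¹) h2)
  refine ⟨(((2 * Real.pi) ^ (-(n : ℝ) / 2) : ℝ) : ℂ) •
    SchwartzMap.compCLMOfContinuousLinearEquiv ℝ L (𝓕 φ), fun y => ?_⟩
  have hL : L y = (2 * Real.pi)⁻¹ • y := rfl
  simp only [_root_.smul_apply, SchwartzMap.compCLMOfContinuousLinearEquiv_apply,
    Function.comp_apply, SchwartzMap.fourier_coe, Real.fourier_eq', smul_eq_mul, hL, fourierE]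
  congr 1
  refine integral_congr_ae (Eventually.of_forall fun x => ?_)
  simp only
  congr 2
  rw [real_inner_smul_right, real_inner_comm]
  have : (Real.pi : ℂ) ≠ 0 := by exact_mod_cast Real.pi_ne_zero
  push_cast
  field_simp

lemma weight_integrable {n : ℕ} (s t : ℝ) (ht : -(n : ℝ) / 2 < t) (φ : 𝓢(E n, ℂ)) :
    Integrable (fun y : E n => weight s t y * ‖φ y‖ ^ 2) := by
  have hm : AEStronglyMeasurable (fun y : E n => weight s t y * ‖φ y‖ ^ 2) volume :=
    ((weight_measurable s t).mul
      (φ.continuous.measurable.norm.pow_const 2)).aestronglyMeasurable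
  rcases Nat.eq_zero_or_pos n with h0 | hn
  · subst h0
    have h : IntegrableOn (fun y : E 0 => weight s t y * ‖φ y‖ ^ 2) {0} :=
      integrableOn_singleton (by finiteness)
    have hu : ({0} : Set (E 0)) = Set.univ :=
      Set.eq_univ_of_forall fun y => Subsingleton.elim y 0
    rwa [hu, integrableOn_univ] at h
  · obtain ⟨N, hN⟩ := exists_nat_gt (max (s - t) ((n + 2 * t) / 2 + (s - t)))
    have hN1 : s - t < N := lt_of_le_of_lt (le_max_left _ _) hN
    have hN2 : (n + 2 * t) / 2 + (s - t) < N := lt_of_le_of_lt (le_max_right _ _) hN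
    have hi := radial_integrable n hn t (N - (s - t)) ht (by linarith) (by linarith)
    let C : ℝ := 2 ^ N * ((Finset.Iic (N, 0)).sup fun m => SchwartzMap.seminorm ℝ m.1 m.2) φ
    refine Integrable.mono' (hi.mul_const (C ^ 2)) hm (Eventually.of_forall fun y => ?_)
    have hC : (1 + ‖y‖) ^ N * ‖φ y‖ ≤ C := by
      have := SchwartzMap.one_add_le_sup_seminorm_apply (𝕜 := ℝ) (m := (N, 0)) (k := N) (n := 0)
        le_rfl le_rfl φ y
      simpa using this
    have hb : (1 + ‖y‖ ^ 2) ^ N * ‖φ y‖ ^ 2 ≤ C ^ 2 := by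
      calc (1 + ‖y‖ ^ 2) ^ N * ‖φ y‖ ^ 2
          ≤ ((1 + ‖y‖) ^ 2) ^ N * ‖φ y‖ ^ 2 := by
            gcongr
            nlinarith [norm_nonneg y]
        _ = ((1 + ‖y‖) ^ N * ‖φ y‖) ^ 2 := by rw [← pow_mul, mul_comm 2 N, pow_mul]; ring
        _ ≤ C ^ 2 := by gcongr
    rw [Real.norm_of_nonneg (mul_nonneg (weight_nonneg _ _ _) (by positivity)), weight]
    have hp : 0 < 1 + ‖y‖ ^ 2 := by positivity
    have hsplit : (1 + ‖y‖ ^ 2) ^ (s - t)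
        = (1 + ‖y‖ ^ 2) ^ (-((N : ℝ) - (s - t))) * (1 + ‖y‖ ^ 2) ^ N := by
      rw [← Real.rpow_natCast (1 + ‖y‖ ^ 2) N, ← Real.rpow_add hp]; congr 1; ring
    rw [hsplit]
    calc _ = (‖y‖ ^ (2 * t) * (1 + ‖y‖ ^ 2) ^ (-((N : ℝ) - (s - t)))) *
          ((1 + ‖y‖ ^ 2) ^ N * ‖φ y‖ ^ 2) := by ring
      _ ≤ _ := by gcongr

/-- The weighted Fourier transform of a component. -/
def weightedFourier {n : ℕ} (s t : ℝ) (φ : 𝓢(E n, ℂ)) (y : E n) : ℂ :=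
  ((Real.sqrt (weight s t y) : ℝ) : ℂ) * fourierE φ y

lemma weightedFourier_sq {n : ℕ} (s t : ℝ) (φ : 𝓢(E n, ℂ)) (y : E n) :
    ‖weightedFourier s t φ y‖ ^ 2 = weight s t y * ‖fourierE φ y‖ ^ 2 := by
  rw [weightedFourier, norm_mul, mul_pow, Complex.norm_real, Real.norm_eq_abs, sq_abs,
    Real.sq_sqrt (weight_nonneg s t y)]

lemma weightedFourier_memLp {n : ℕ} (s t : ℝ) (ht : -(n : ℝ) / 2 < t) (φ : 𝓢(E n, ℂ)) :
    MemLp (weightedFourier s t φ) 2 volume := by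
  obtain ⟨ψ, hψ⟩ := fourierE_schwartz φ
  have hm : AEStronglyMeasurable (weightedFourier s t φ) volume := by
    have : weightedFourier s t φ = fun y => ((Real.sqrt (weight s t y) : ℝ) : ℂ) * ψ y := by
      funext y; rw [weightedFourier, hψ]
    rw [this]
    exact ((Complex.measurable_ofReal.comp (weight_measurable s t).sqrt).mul
      ψ.continuous.measurable).aestronglyMeasurable
  rw [memLp_two_iff_integrable_sq_norm hm]
  simpa only [weightedFourier_sq, hψ] using weight_integrable s t ht ψ

lemma fourierE_add {n : ℕ} (φ ψ : 𝓢(E n, ℂ)) (y : E n) :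
    fourierE (⇑(φ + ψ)) y = fourierE φ y + fourierE ψ y := by
  have hi : ∀ χ : 𝓢(E n, ℂ), Integrable
      (fun x : E n => Complex.exp (-(Complex.I * ((⟪y, x⟫_ℝ : ℝ) : ℂ))) * χ x) := by
    intro χ
    refine χ.integrable.bdd_mul (c := 1) (by fun_prop) (Eventually.of_forall fun x => ?_)
    rw [Complex.norm_exp]; simp
  simp only [fourierE, _root_.add_apply, mul_add]
  rw [integral_add (hi φ) (hi ψ), mul_add]

lemma fourierE_neg {n : ℕ} (φ : 𝓢(E n, ℂ)) (y : E n) :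
    fourierE (⇑(-φ)) y = -fourierE φ y := by
  simp [fourierE, integral_neg]

/-- The components of the weighted Fourier transform as an element of a Hilbert space. -/
def toL2 {n : ℕ} (s t : ℝ) (ht : -(n : ℝ) / 2 < t) (f : Fin n → 𝓢(E n, ℂ)) :
    PiLp 2 (fun _ : Fin n => Lp ℂ 2 (volume : Measure (E n))) :=
  WithLp.toLp 2 fun i => (weightedFourier_memLp s t ht (f i)).toLp _

lemma sobolevSq_eq {n : ℕ} (s t : ℝ) (ht : -(n : ℝ) / 2 < t) (f : Fin n → 𝓢(E n, ℂ)) :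
    Real.sqrt (sobolevSq s t f) = ‖toL2 s t ht f‖ := by
  rw [PiLp.norm_eq_of_L2]
  congr 1
  refine Finset.sum_congr rfl fun i _ => ?_
  have h := (weightedFourier_memLp s t ht (f i))
  have := @L2.inner_def (E n) ℂ ℂ _ _ _ _ _ (h.toLp _) (h.toLp _)
  have h3 : ‖h.toLp _‖ ^ 2 = ∫ y, ‖(h.toLp _) y‖ ^ 2 := by
    have h4 := congrArg Complex.re this
    rw [inner_self_eq_norm_sq_to_K] at h4
    have h5 : (∫ a, (⟪(h.toLp _) a, (h.toLp _) a⟫_ℂ : ℂ))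
        = ((∫ y, ‖(h.toLp _) y‖ ^ 2 : ℝ) : ℂ) := by
      rw [← integral_complex_ofReal]
      refine integral_congr_ae (Eventually.of_forall fun y => ?_)
      simp only [inner_self_eq_norm_sq_to_K]
      push_cast; rfl
    rw [h5, Complex.ofReal_re] at h4
    rw [← h4]
    norm_cast
  change _ = ‖h.toLp _‖ ^ 2
  rw [h3]
  refine integral_congr_ae ?_
  filter_upwards [h.coeFn_toLp] with y hy
  rw [hy, weightedFourier_sq]

/-- The norm `‖f‖_{H^s_t}` as a seminorm of additive groups. -/
def sobolevNorm (n : ℕ) (s t : ℝ) (ht : -(n : ℝ) / 2 < t) :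
    AddGroupSeminorm (SchwartzField n s t ht) where
  toFun f := Real.sqrt (sobolevSq s t f.comp)
  map_zero' := by
    have h : ∀ y : E n, fourierE (⇑(0 : 𝓢(E n, ℂ))) y = 0 := fun y => by simp [fourierE]
    have : sobolevSq s t (0 : Fin n → 𝓢(E n, ℂ)) = 0 := by
      simp only [sobolevSq, Pi.zero_apply, h]; simp
    exact (congrArg Real.sqrt this).trans Real.sqrt_zero
  add_le' f g := by
    rw [sobolevSq_eq s t ht, sobolevSq_eq s t ht, sobolevSq_eq s t ht]
    have : toL2 s t ht (f + g).comp = toL2 s t ht f.comp + toL2 s t ht g.comp := by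
      ext1 i
      refine Eq.trans ?_ (MemLp.toLp_add (weightedFourier_memLp s t ht (f.comp i))
        (weightedFourier_memLp s t ht (g.comp i)))
      refine MemLp.toLp_congr (weightedFourier_memLp s t ht ((f + g).comp i)) _ (Eventually.of_forall fun y => ?_)
      change _ * fourierE (⇑(f.comp i + g.comp i)) y = _
      rw [fourierE_add, mul_add]; rfl
    exact this ▸ norm_add_le _ _
  neg' f := by
    congr 1
    refine Finset.sum_congr rfl fun i _ => ?_
    refine integral_congr_ae (Eventually.of_forall fun y => ?_)
    change _ * ‖fourierE (⇑(-(f.comp i))) y‖ ^ 2 = _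
    rw [fourierE_neg, norm_neg]

instance (n : ℕ) (s t : ℝ) (ht : -(n : ℝ) / 2 < t) :
    SeminormedAddCommGroup (SchwartzField n s t ht) :=
  (sobolevNorm n s t ht).toSeminormedAddCommGroup

lemma norm_sq_eq {n : ℕ} {s t : ℝ} {ht : -(n : ℝ) / 2 < t} (f : SchwartzField n s t ht) :
    ‖f‖ ^ 2 = sobolevSq s t f.comp := by
  refine Real.sq_sqrt (Finset.sum_nonneg fun i _ => integral_nonneg fun y => ?_)
  exact mul_nonneg (weight_nonneg s t y) (by positivity)

/-- The Hilbert space `H^s_t(ℝⁿ; ℂⁿ)`: the completion of the Schwartz vector fields with respect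
to the `H^s_t` norm. -/
abbrev H (n : ℕ) (s t : ℝ) (ht : -(n : ℝ) / 2 < t) : Type :=
  UniformSpace.Completion (SchwartzField n s t ht)

/-! ### Functions on `TSⁿ⁻¹ = {(x, ξ) : |ξ| = 1, ⟨x, ξ⟩ = 0}`

A function on `TSⁿ⁻¹` is given by a function on `ℝⁿ × ℝⁿ`, of which only the values at points of
`TSⁿ⁻¹` are used. -/

/-- The Fourier transform on `TSⁿ⁻¹`:
`(2π)^{-(n-1)/2} ∫_{ξ^⊥} e^{-i⟨y,x⟩} φ(x,ξ) dx`. -/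
def fourierTS {n : ℕ} (φ : E n × E n → ℂ) (p : E n × E n) : ℂ :=
  (((2 * Real.pi) ^ (-((n : ℝ) - 1) / 2) : ℝ) : ℂ) *
    ∫ x : (ℝ ∙ p.2)ᗮ, Complex.exp (-(Complex.I * ((⟪p.1, (x : E n)⟫_ℝ : ℝ) : ℂ))) *
      φ ((x : E n), p.2)

/-- For `g = φ̂` this is the squared norm `‖φ‖²_{H^s_t(TSⁿ⁻¹)}`,
`(2π)⁻¹ ∫_{Sⁿ⁻¹} ∫_{ξ^⊥} |y|^{2t} (1 + |y|²)^{s-t} |g(y,ξ)|² dy dξ`. -/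
def normSqTS {n : ℕ} (s t : ℝ) (g : E n × E n → ℂ) : ℝ≥0∞ :=
  ENNReal.ofReal (2 * Real.pi)⁻¹ *
    ∫⁻ ξ : Metric.sphere (0 : E n) 1, (∫⁻ y : (ℝ ∙ (ξ : E n))ᗮ,
      ENNReal.ofReal (weight s t (y : E n) * ‖g ((y : E n), (ξ : E n))‖ ^ 2))
      ∂((volume : Measure (E n)).toSphere)

/-- The momentum ray transform `(Iᵏf)(x,ξ) = ∫ τᵏ ⟨f(x + τξ), ξ⟩ dτ` of a vector field. -/
def momentRay {n : ℕ} (k : ℕ) (f : Fin n → 𝓢(E n, ℂ)) (p : E n × E n) : ℂ :=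
  ∫ τ : ℝ, (τ : ℂ) ^ k * ∑ i, f i (p.1 + τ • p.2) * ((p.2 i : ℝ) : ℂ)

/-- The extension of a function from `TSⁿ⁻¹` to `{(x,ξ) : ξ ≠ 0}` that is constant along the
fibres of `(x, ξ) ↦ (x - ⟨ξ,x⟩ξ/|ξ|², ξ/|ξ|)`; smooth if the function is. -/
def extendTS {n : ℕ} (φ : E n × E n → ℂ) (p : E n × E n) : ℂ :=
  φ (p.1 - (⟪p.2, p.1⟫_ℝ / ‖p.2‖ ^ 2) • p.2, ‖p.2‖⁻¹ • p.2)

/-- The vector field `∂/∂ξⁱ - xᵢ ξᵖ ∂/∂xᵖ - ξᵢ ξᵖ ∂/∂ξᵖ` on `ℝⁿ × (ℝⁿ ∖ 0)`, which is tangent to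
`TSⁿ⁻¹` at the points of `TSⁿ⁻¹`. -/
def xiField {n : ℕ} (i : Fin n) (p : E n × E n) : E n × E n :=
  (-(p.1 i • p.2), EuclideanSpace.single i 1 - p.2 i • p.2)

/-- The first order differential operator `Ξᵢ` on `TSⁿ⁻¹`, the restriction of `xiField i`. -/
def Xi {n : ℕ} (i : Fin n) (φ : E n × E n → ℂ) (p : E n × E n) : ℂ :=
  fderiv ℝ (extendTS φ) p (xiField i p)

/-! ### Extension of operators from Schwartz fields to `H^s_t(ℝⁿ; ℂⁿ)` -/

/-- The pairing `∫_{Sⁿ⁻¹} ∫_{ξ^⊥} χ(y,ξ) g(y,ξ) dy dξ`. -/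
def pairTS {n : ℕ} (g : E n × E n → ℂ) (χ : E n × E n → ℝ) : ℂ :=
  ∫ ξ : Metric.sphere (0 : E n) 1, (∫ y : (ℝ ∙ (ξ : E n))ᗮ,
    (χ ((y : E n), (ξ : E n)) : ℂ) * g ((y : E n), (ξ : E n)))
    ∂((volume : Measure (E n)).toSphere)

/-- Test functions: smooth with compact support disjoint from the zero section `{y = 0}`. -/
structure IsTest {n : ℕ} (χ : E n × E n → ℝ) : Prop where
  smooth : ContDiff ℝ ∞ χ
  compact : HasCompactSupport χ
  away : ∀ p ∈ tsupport χ, p.1 ≠ 0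

/-- Let `A` map Schwartz vector fields to functions on `TSⁿ⁻¹`, and let `f ∈ H^s_t(ℝⁿ; ℂⁿ)`.
`RepresentsFourier A f g` says that `Af`, defined by continuity in the sense of distributions,
has the Fourier transform `g`: for every test function `χ`, the pairing of the Fourier transform
of `Au` with `χ` tends to the pairing of `g` with `χ` as the Schwartz fields `u` tend to `f` in
`H^s_t(ℝⁿ; ℂⁿ)`. -/
def RepresentsFourier {n : ℕ} {s t : ℝ} {ht : -(n : ℝ) / 2 < t}
    (A : (Fin n → 𝓢(E n, ℂ)) → E n × E n → ℂ) (f : H n s t ht) (g : E n × E n → ℂ) : Prop :=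
  ∀ χ : E n × E n → ℝ, IsTest χ →
    Tendsto (fun u : SchwartzField n s t ht => pairTS (fourierTS (A u.comp)) χ)
      (comap (fun u : SchwartzField n s t ht => (u : H n s t ht)) (𝓝 f)) (𝓝 (pairTS g χ))

/-- The squared norm `‖Af‖²_{H^{s'}_{t'}(TSⁿ⁻¹)} ∈ [0, ∞]` for `f ∈ H^s_t(ℝⁿ; ℂⁿ)`: the value at
the Fourier transform of `Af`, which is unique almost everywhere if it is a function of finite
norm, and `∞` if there is no such function. -/
def extNormSq {n : ℕ} {s t : ℝ} {ht : -(n : ℝ) / 2 < t} (s' t' : ℝ)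
    (A : (Fin n → 𝓢(E n, ℂ)) → E n × E n → ℂ) (f : H n s t ht) : ℝ≥0∞ :=
  ⨅ (g : E n × E n → ℂ) (_ : Measurable g) (_ : RepresentsFourier A f g), normSqTS s' t' g

/-- The constant `a_n = Γ((n-1)/2) / (2 π^{(n-1)/2})`. -/
def a (n : ℕ) : ℝ :=
  Real.Gamma (((n : ℝ) - 1) / 2) / (2 * Real.pi ^ (((n : ℝ) - 1) / 2))

end MomentumRay

end

noncomputable section

namespace MomentumRay

/-! On the Fourier side the field can be recovered pointwise from the three kinds of data. For a
unit vector `ξ` and `y ⟂ ξ`, the slice theorem (`fourierTS_of_ray`) expresses the transforms of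
`I⁰f` and `I¹f` as `√(2π)` times the transforms on `ℝⁿ` of `⟨f, ξ⟩` and `⟨ξ, ·⟩⟨f, ξ⟩`.
Differentiating under the ray integral shows that `Ξᵢ(I⁰f)` is the ray integral of another Schwartz
function, and the terms left after the slice theorem rearrange (`fourierE_eq_xiFourier`) to `√(2π)
f̂ᵢ = gᵢ + ξᵢ g₀ - i yᵢ g₁`, where `gᵢ`, `g₀`, `g₁` are the transforms of `Ξᵢ(I⁰f)`, `I⁰f`, `I¹f`.
The vectors `(gᵢ)` and `y` are orthogonal to `ξ`, so `ξ g₀` splits off by Pythagoras, and only the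
sum of `g` and `-i y g₁` costs the factor `2` (`sum_norm_sq_le`).

To integrate this over `TSⁿ⁻¹`, one needs that `a_n |y| dy dξ` pushes forward to Lebesgue measure
under `(y, ξ) ↦ y` (`lintegral_eq_hyperplaneMeasure`). After multiplication by suitable powers of
`|y|`, both measures on `ℝⁿ` become invariant under rotations and dilations. These act transitively
on nonzero vectors, which forces proportionality (`ConfInvariant.lintegral_mul_le`); testing on the
unit ball gives the constant. The extra factor `|y|` raises the Sobolev exponents by `1/2`, and the
`|y|²` in front of `g₁` raises them by one more.

For general `f`, the same identity embeds `H^s_t` isometrically into a weighted `L²` space over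
`TSⁿ⁻¹` (`embedH`). Pairings with test functions are continuous there, so the recovery formula and
the orthogonality of `g` to `ξ` pass to the limit as distributions. All functions involved are
locally integrable off the zero section, hence both relations hold almost everywhere, and the
pointwise estimate is integrated as before (`norm_sq_le_of_represents`). -/

variable {n : ℕ}

/-! ### The measure `dy dξ` on `TSⁿ⁻¹` -/

/-- Cartesian coordinates `x = y + τξ` adapted to a unit vector `ξ` preserve the volume. -/
lemma measurePreserving_add_smul {V : Type*} [NormedAddCommGroup V] [InnerProductSpace ℝ V]
    [FiniteDimensional ℝ V] [MeasurableSpace V] [BorelSpace V] {ξ : V} (hξ : ‖ξ‖ = 1) :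
    MeasurePreserving (fun p : (ℝ ∙ ξ)ᗮ × ℝ => (p.1 : V) + p.2 • ξ)
      (volume.prod volume) volume := by
  have h1 := (LinearIsometryEquiv.toSpanUnitSingleton (𝕜 := ℝ) ξ hξ).measurePreserving.prod
    (MeasurePreserving.id (volume : Measure (ℝ ∙ ξ)ᗮ))
  have h2 : MeasurePreserving (WithLp.toLp 2 : (ℝ ∙ ξ) × (ℝ ∙ ξ)ᗮ → _)
    (volume.prod volume) volume := WithLp.volume_preserving_toLp (U := (ℝ ∙ ξ)) (V := (ℝ ∙ ξ)ᗮ)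
  have h3 := (ℝ ∙ ξ).orthogonalDecomposition.symm.measurePreserving
  have h4 := (h3.comp h2).comp
      (h1.comp (Measure.measurePreserving_swap (μ := (volume : Measure (ℝ ∙ ξ)ᗮ))
        (ν := (volume : Measure ℝ))))
  have h5 : (fun p : (ℝ ∙ ξ)ᗮ × ℝ => (p.1 : V) + p.2 • ξ) =
      ((ℝ ∙ ξ).orthogonalDecomposition.symm ∘ WithLp.toLp 2) ∘
        Prod.map (LinearIsometryEquiv.toSpanUnitSingleton ξ hξ) id ∘ Prod.swap := by
    funext p
    simp [add_comm]
  rw [h5]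
  exact h4

lemma inner_add_smul {ξ : E n} (hξ : ‖ξ‖ = 1) (y : (ℝ ∙ ξ)ᗮ) (τ : ℝ) :
    ⟪ξ, (y : E n) + τ • ξ⟫_ℝ = τ := by
  rw [inner_add_right, Submodule.mem_orthogonal_singleton_iff_inner_right.1 y.2,
    real_inner_smul_right, real_inner_self_eq_norm_sq, hξ]
  ring

/-- The points at height between `0` and `1` over the hyperplane `ξ^⊥`. -/
def slab (ξ : E n) : Set (E n) := {x | ⟪ξ, x⟫_ℝ ∈ Set.Ioc (0 : ℝ) 1}

/-- The orthogonal projection to `ξ^⊥`, where `|ξ| = 1`. -/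
def projPerp (ξ x : E n) : E n := x - ⟪ξ, x⟫_ℝ • ξ

lemma continuous_projPerp : Continuous fun q : E n × E n => projPerp q.1 q.2 := by
  unfold projPerp; fun_prop

lemma measurableSet_slab (ξ : E n) : MeasurableSet (slab ξ) :=
  (by fun_prop : Measurable fun x : E n => ⟪ξ, x⟫_ℝ) measurableSet_Ioc

/-- In the coordinates `y + τξ` the slab is `ξ^⊥ × (0, 1]`, and the second factor has length one.
This trades integration over the varying subspace `ξ^⊥` for integration over the fixed space `ℝⁿ`,
which makes the fibre measures jointly measurable in `ξ`. -/
lemma map_projPerp {ξ : E n} (hξ : ‖ξ‖ = 1) :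
    (volume.restrict (slab ξ)).map (projPerp ξ) =
      (volume : Measure (ℝ ∙ ξ)ᗮ).map Subtype.val := by
  have hc : Measurable (projPerp ξ) :=
    (continuous_projPerp.comp (by fun_prop : Continuous fun x : E n => (ξ, x))).measurable
  ext B hB
  rw [Measure.map_apply hc hB, Measure.restrict_apply (hc hB),
    Measure.map_apply measurable_subtype_coe hB,
    ← (measurePreserving_add_smul hξ).measure_preimage
      ((hc hB).inter (measurableSet_slab ξ)).nullMeasurableSet]
  have : (fun p : (ℝ ∙ ξ)ᗮ × ℝ => (p.1 : E n) + p.2 • ξ) ⁻¹' (projPerp ξ ⁻¹' B ∩ slab ξ) =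
      ((Subtype.val : (ℝ ∙ ξ)ᗮ → E n) ⁻¹' B) ×ˢ Set.Ioc (0 : ℝ) 1 := by
    ext p
    simp only [Set.mem_preimage, Set.mem_inter_iff, slab, projPerp, Set.mem_ofPred_eq,
      inner_add_smul hξ, Set.mem_prod, add_sub_cancel_right]
  rw [this, Measure.prod_prod]
  simp

/-- The measure `dy dξ` on `TSⁿ⁻¹` as a measure on `ℝⁿ × ℝⁿ`. -/
def measureTS (n : ℕ) : Measure (E n × E n) :=
  (((volume : Measure (E n)).toSphere.prod volume).restrict
    {q | q.2 ∈ slab (q.1 : E n)}).map fun q => (projPerp (q.1 : E n) q.2, (q.1 : E n))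

instance : SFinite ((volume : Measure (E n)).toSphere.prod (volume : Measure (E n))) :=
  Measure.prod.instSFinite

instance : SFinite (measureTS n) := by unfold measureTS; infer_instance

lemma continuous_toTS : Continuous fun q : Metric.sphere (0 : E n) 1 × E n =>
    (projPerp (q.1 : E n) q.2, (q.1 : E n)) :=
  (continuous_projPerp.comp (by fun_prop : Continuous fun q : Metric.sphere (0 : E n) 1 × E n =>
    ((q.1 : E n), q.2))).prodMk (by fun_prop)

lemma measurableSet_slabs :
    MeasurableSet {q : Metric.sphere (0 : E n) 1 × E n | q.2 ∈ slab (q.1 : E n)} :=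
  (by fun_prop : Continuous fun q : Metric.sphere (0 : E n) 1 × E n =>
    ⟪(q.1 : E n), q.2⟫_ℝ).measurable measurableSet_Ioc

lemma norm_sphere (ξ : Metric.sphere (0 : E n) 1) : ‖(ξ : E n)‖ = 1 := by simp

/-- Tonelli on sphere × `ℝⁿ`, followed by `map_projPerp` in each fibre. With a single measure on `ℝⁿ
× ℝⁿ` in place of an iterated integral, the usual tools on almost everywhere statements, `L²` and
local integrability apply. -/
lemma lintegral_measureTS {F : E n × E n → ℝ≥0∞} (hF : Measurable F) :
    ∫⁻ p, F p ∂measureTS n = ∫⁻ ξ : Metric.sphere (0 : E n) 1, (∫⁻ y : (ℝ ∙ (ξ : E n))ᗮ,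
      F ((y : E n), (ξ : E n))) ∂((volume : Measure (E n)).toSphere) := by
  rw [measureTS, lintegral_map hF continuous_toTS.measurable,
    ← lintegral_indicator measurableSet_slabs]
  refine (lintegral_prod _
      ((hF.comp continuous_toTS.measurable).indicator measurableSet_slabs).aemeasurable).trans ?_
  refine lintegral_congr fun ξ => ?_
  have hc : Measurable fun x : E n => projPerp (ξ : E n) x :=
    (continuous_projPerp.comp (by fun_prop : Continuous fun x : E n => ((ξ : E n), x))).measurable
  have h := congrArg (fun μ => ∫⁻ x, F (x, (ξ : E n)) ∂μ) (map_projPerp (norm_sphere ξ))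
  have hs : Measurable fun x : E n => F (x, (ξ : E n)) := hF.comp (by fun_prop)
  rw [lintegral_map hs hc, lintegral_map hs
    measurable_subtype_coe, ← lintegral_indicator (measurableSet_slab _)] at h
  exact h

lemma integral_measureTS {F : E n × E n → ℂ} (hm : Measurable F) (hF : Integrable F (measureTS n)) :
    ∫ p, F p ∂measureTS n = ∫ ξ : Metric.sphere (0 : E n) 1, (∫ y : (ℝ ∙ (ξ : E n))ᗮ,
      F ((y : E n), (ξ : E n))) ∂((volume : Measure (E n)).toSphere) := by
  have hT := (continuous_toTS (n := n)).measurable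
  have hF' : Integrable ({q : Metric.sphere (0 : E n) 1 × E n | q.2 ∈ slab (q.1 : E n)}.indicator
      (fun q => F (projPerp (q.1 : E n) q.2, (q.1 : E n))))
      ((volume : Measure (E n)).toSphere.prod volume) :=
    (integrable_indicator_iff measurableSet_slabs).2 (hF.comp_measurable hT)
  rw [measureTS, integral_map hT.aemeasurable hF.1, ← integral_indicator measurableSet_slabs]
  refine (integral_prod _ hF').trans (integral_congr_ae ?_)
  refine Eventually.of_forall fun ξ => ?_
  have hc : Measurable fun x : E n => projPerp (ξ : E n) x :=
    (continuous_projPerp.comp (by fun_prop : Continuous fun x : E n => ((ξ : E n), x))).measurable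
  have h := congrArg (fun μ => ∫ x, F (x, (ξ : E n)) ∂μ) (map_projPerp (norm_sphere ξ))
  have hs : Measurable fun x : E n => F (x, (ξ : E n)) := hm.comp (by fun_prop)
  rw [integral_map hc.aemeasurable hs.aestronglyMeasurable,
    integral_map measurable_subtype_coe.aemeasurable hs.aestronglyMeasurable,
    ← integral_indicator (measurableSet_slab _)] at h
  exact h

/-- A point of the slab whose projection has norm at most `R` has norm at most `R + 1`, and the
sphere has finite measure. -/
lemma measureTS_closedBall_lt_top (R : ℝ) :
    measureTS n (Prod.fst ⁻¹' Metric.closedBall (0 : E n) R) < ⊤ := by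
  have hm : MeasurableSet (Prod.fst ⁻¹' Metric.closedBall (0 : E n) R : Set (E n × E n)) :=
    measurable_fst Metric.isClosed_closedBall.measurableSet
  rw [measureTS, Measure.map_apply continuous_toTS.measurable hm]
  rw [Measure.restrict_apply (continuous_toTS.measurable hm)]
  refine (measure_mono (t := Set.univ ×ˢ Metric.closedBall (0 : E n) (R + 1))
    fun q hq => ⟨trivial, ?_⟩).trans_lt ?_
  · have h1 : ‖projPerp (q.1 : E n) q.2‖ ≤ R := by simpa using hq.1
    have h2 : ‖⟪(q.1 : E n), q.2⟫_ℝ • (q.1 : E n)‖ ≤ 1 := by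
      rw [norm_smul, norm_sphere, mul_one, Real.norm_of_nonneg hq.2.1.le]
      exact hq.2.2
    have h3 : q.2 = projPerp (q.1 : E n) q.2 + ⟪(q.1 : E n), q.2⟫_ℝ • (q.1 : E n) := by
      simp [projPerp]
    rw [mem_closedBall_zero_iff, h3]
    exact (norm_add_le _ _).trans (add_le_add h1 h2)
  · rw [Measure.prod_prod]
    exact ENNReal.mul_lt_top (measure_lt_top _ _) measure_closedBall_lt_top

instance : IsFiniteMeasureOnCompacts (measureTS n) := by
  constructor
  intro K hK
  obtain ⟨R, hR⟩ := (hK.image continuous_fst).isBounded.subset_closedBall 0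
  exact (measure_mono (t := Prod.fst ⁻¹' Metric.closedBall (0 : E n) R)
    fun p hp => hR ⟨p, hp, rfl⟩).trans_lt (measureTS_closedBall_lt_top R)

lemma ae_measureTS : ∀ᵐ p ∂measureTS n, ‖p.2‖ = 1 ∧ ⟪p.1, p.2⟫_ℝ = 0 := by
  rw [measureTS, ae_map_iff continuous_toTS.measurable.aemeasurable]
  · refine Eventually.of_forall fun q => ⟨norm_sphere q.1, ?_⟩
    rw [projPerp, inner_sub_left, real_inner_smul_left, real_inner_self_eq_norm_sq, norm_sphere,
      real_inner_comm]
    ring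
  · exact (by fun_prop : Continuous fun p : E n × E n => (‖p.2‖, ⟪p.1, p.2⟫_ℝ)).measurable
      (measurableSet_singleton (1, 0)) |>.congr (by ext; simp)

lemma finrank_perp {ξ : E n} (hξ : ‖ξ‖ = 1) : Module.finrank ℝ (ℝ ∙ ξ)ᗮ = n - 1 := by
  have h := (ℝ ∙ ξ).finrank_add_finrank_orthogonal
  rw [finrank_span_singleton (norm_ne_zero_iff.1 (hξ ▸ one_ne_zero)),
    finrank_euclideanSpace_fin] at h
  omega

/-- For `n ≥ 2` the fibre `ξ^⊥` has positive dimension, so its origin is a null set. -/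
lemma ae_measureTS_ne_zero (hn : 2 ≤ n) : ∀ᵐ p ∂measureTS n, p.1 ≠ 0 := by
  have hm : MeasurableSet {p : E n × E n | p.1 = 0} := measurable_fst (measurableSet_singleton 0)
  rw [ae_iff]
  simp only [not_not]
  rw [← lintegral_indicator_one hm, lintegral_measureTS (measurable_one.indicator hm)]
  refine (lintegral_congr fun ξ => ?_).trans lintegral_zero
  have hd := finrank_perp (norm_sphere ξ)
  have : Nontrivial (ℝ ∙ (ξ : E n))ᗮ := Module.nontrivial_of_finrank_pos (R := ℝ) (by omega)
  refine (lintegral_congr fun y => ?_).trans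
    ((lintegral_indicator_one (measurableSet_singleton (0 : (ℝ ∙ (ξ : E n))ᗮ))).trans
      (measure_singleton 0))
  simp [Set.indicator_apply]

/-! ### Uniqueness of measures invariant under rotations and dilations -/

/-- The points at relative distance less than `r` from `x`. -/
def relBall (r : ℝ) (x : E n) : Set (E n) := {y | ‖x - y‖ < r * min ‖x‖ ‖y‖}

lemma isOpen_relBall_graph (r : ℝ) : IsOpen {p : E n × E n | p.2 ∈ relBall r p.1} := by
  simp only [relBall, Set.mem_ofPred_eq]
  exact isOpen_lt (by fun_prop) (by fun_prop)

lemma isOpen_relBall (r : ℝ) (x : E n) : IsOpen (relBall r x) :=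
  isOpen_lt (by fun_prop) (by fun_prop)

lemma mem_relBall_comm {r : ℝ} {x y : E n} : y ∈ relBall r x ↔ x ∈ relBall r y := by
  simp only [relBall, Set.mem_ofPred_eq, norm_sub_rev x y, min_comm ‖x‖]

lemma relBall_zero (r : ℝ) : relBall r (0 : E n) = ∅ := by
  ext y
  simp [relBall]

lemma mem_relBall_self {r : ℝ} (hr : 0 < r) {x : E n} (hx : x ≠ 0) : x ∈ relBall r x := by
  simpa [relBall, hr] using hx

lemma relBall_subset_ball {r : ℝ} (hr : 0 ≤ r) (x : E n) :
    relBall r x ⊆ Metric.ball x (r * ‖x‖) := fun y hy => by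
  rw [mem_ball_iff_norm, norm_sub_rev]
  exact lt_of_lt_of_le hy (mul_le_mul_of_nonneg_left (min_le_left _ _) hr)

/-- A measure on `ℝⁿ` is conformally invariant if rotations and dilations preserve it. -/
structure ConfInvariant (N : Measure (E n)) : Prop where
  isometry : ∀ U : E n ≃ₗᵢ[ℝ] E n, N.map U = N
  dilation : ∀ c : ℝ, 0 < c → N.map (fun y => c • y) = N
  zero : N {0} = 0
  finite : ∀ r R : ℝ, 0 < r → N (Metric.closedBall 0 R \ Metric.ball 0 r) < ⊤

/-- Dilations and isometries preserve the relation defining `relBall`, and together they carry any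
nonzero vector to any other. -/
lemma ConfInvariant.relBall_eq {N : Measure (E n)} (hN : ConfInvariant N) (r : ℝ) {x e : E n}
    (hx : x ≠ 0) (he : e ≠ 0) : N (relBall r x) = N (relBall r e) := by
  have hx' := norm_pos_iff.2 hx
  have he' := norm_pos_iff.2 he
  set c := ‖e‖ / ‖x‖ with hc
  have hc0 : 0 < c := div_pos he' hx'
  have hn : ‖c • x‖ = ‖e‖ := by
    rw [norm_smul, Real.norm_of_nonneg hc0.le, hc, div_mul_cancel₀ _ hx'.ne']
  -- After scaling to equal length, the two vectors are exchanged by the reflection in their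
  -- bisecting hyperplane.
  set U := (ℝ ∙ (c • x - e))ᗮ.reflection with hU
  have hUx : U (c • x) = e := Submodule.reflection_sub hn
  conv_rhs => rw [← hN.isometry U, ← hN.dilation c hc0]
  have hd : Measurable fun y : E n => c • y := by fun_prop
  have hUm : Measurable U := U.continuous.measurable
  rw [Measure.map_map hUm hd, Measure.map_apply (hUm.comp hd) (isOpen_relBall r e).measurableSet]
  congr 1
  ext y
  simp only [relBall, Set.mem_ofPred_eq, Set.mem_preimage, Function.comp_apply]
  rw [← hUx, ← map_sub, U.norm_map, U.norm_map, U.norm_map, ← smul_sub, norm_smul, norm_smul,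
    norm_smul, Real.norm_of_nonneg hc0.le, ← mul_min_of_nonneg _ _ hc0.le, mul_left_comm,
    mul_lt_mul_iff_right₀ hc0]

lemma ConfInvariant.relBall_lt_top {N : Measure (E n)} (hN : ConfInvariant N) {r : ℝ}
    (hr : 0 ≤ r) (hr' : r ≤ 1 / 2) {e : E n} (he : e ≠ 0) : N (relBall r e) < ⊤ := by
  refine (measure_mono fun y hy => ?_).trans_lt
    (hN.finite (‖e‖ / 2) (2 * ‖e‖) (half_pos (norm_pos_iff.2 he)))
  have h1 : ‖e - y‖ < r * ‖e‖ := by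
    have := relBall_subset_ball hr e hy
    rwa [mem_ball_iff_norm, norm_sub_rev] at this
  have h2 : r * ‖e‖ ≤ 1 / 2 * ‖e‖ := mul_le_mul_of_nonneg_right hr' (norm_nonneg _)
  have h3 := norm_sub_norm_le e y
  have h4 := norm_sub_norm_le y e
  rw [norm_sub_rev] at h4
  simp only [Set.mem_sdiff, mem_closedBall_zero_iff, mem_ball_zero_iff, not_lt]
  constructor <;> linarith [norm_nonneg e]

lemma measurable_indicator_relBall (r : ℝ) {h : E n → ℝ≥0∞} (hh : Measurable h) :
    Measurable fun p : E n × E n => (relBall r p.1).indicator h p.2 := by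
  have : (fun p : E n × E n => (relBall r p.1).indicator h p.2) =
      {p : E n × E n | p.2 ∈ relBall r p.1}.indicator fun p => h p.2 := by
    classical
    ext p
    simp [Set.indicator_apply]
  rw [this]
  exact (hh.comp measurable_snd).indicator (isOpen_relBall_graph r).measurableSet

/-- Tonelli and the symmetry of the relation `y ∈ relBall r x`. Only an inequality comes out,
because `relBall r 0` is empty and `L` may charge the origin. -/
lemma lintegral_relBall_comm {N L : Measure (E n)} [SFinite N] [SFinite L]
    (hN : ConfInvariant N) (r : ℝ) {e : E n} (he : e ≠ 0) {h : E n → ℝ≥0∞} (hh : Measurable h) :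
    ∫⁻ x, ∫⁻ y in relBall r x, h y ∂L ∂N ≤ N (relBall r e) * ∫⁻ y, h y ∂L := by
  classical
  calc ∫⁻ x, ∫⁻ y in relBall r x, h y ∂L ∂N
      = ∫⁻ x, ∫⁻ y, (relBall r x).indicator h y ∂L ∂N := by
        simp_rw [lintegral_indicator (isOpen_relBall r _).measurableSet]
    _ = ∫⁻ y, ∫⁻ x, (relBall r x).indicator h y ∂N ∂L := 
        lintegral_lintegral_swap (measurable_indicator_relBall r hh).aemeasurable
    _ = ∫⁻ y, N (relBall r y) * h y ∂L := by
        refine lintegral_congr fun y => ?_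
        rw [mul_comm, ← lintegral_indicator_const (isOpen_relBall r y).measurableSet]
        refine lintegral_congr fun x => ?_
        simp only [Set.indicator_apply, mem_relBall_comm (x := x)]
    _ ≤ ∫⁻ y, N (relBall r e) * h y ∂L := by
        refine lintegral_mono fun y => mul_le_mul_left ?_ _
        rcases eq_or_ne y 0 with rfl | hy
        · simp [relBall_zero]
        · exact (hN.relBall_eq r hy he).le
    _ = _ := lintegral_const_mul _ hh

/-- If `N` vanished on one relative ball, double counting would give `∫ L (relBall r x) dN = 0`. The
integrand is `N`-almost everywhere a nonzero constant, so `N` would be zero. -/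
lemma ConfInvariant.relBall_ne_zero {N L : Measure (E n)} [SFinite N] [SFinite L]
    (hN : ConfInvariant N) (hL : ConfInvariant L) (hN0 : N ≠ 0) {r : ℝ} {e : E n} (he : e ≠ 0)
    (hLr : L (relBall r e) ≠ 0) : N (relBall r e) ≠ 0 := by
  intro h0
  have h := lintegral_relBall_comm (L := L) hN r he measurable_one
  rw [h0, zero_mul] at h
  simp only [Pi.one_apply, lintegral_one, Measure.restrict_apply_univ, nonpos_iff_eq_zero] at h
  have h1 : ∫⁻ _, L (relBall r e) ∂N = ∫⁻ x, L (relBall r x) ∂N := by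
    refine lintegral_congr_ae ?_
    filter_upwards [compl_mem_ae_iff.2 hN.zero] with x hx
    exact hL.relBall_eq r he hx
  rw [h, lintegral_const, mul_eq_zero, or_iff_right hLr, Measure.measure_univ_eq_zero] at h1
  exact hN0 h1

/-- Averaging over small relative balls compares two conformally invariant measures. -/
lemma lintegral_le_liminf {N L : Measure (E n)} [SFinite N] [SFinite L]
    (hN : ConfInvariant N) (hL : ConfInvariant L) {e : E n} (he : e ≠ 0)
    {r : ℕ → ℝ} (hr : ∀ k, 0 < r k) (hr' : ∀ k, r k ≤ 1 / 2) (hr0 : Tendsto r atTop (𝓝 0))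
    (hL0 : ∀ k, L (relBall (r k) e) ≠ 0)
    {h : E n → ℝ≥0∞} (hh : Measurable h) (hl : ∀ x ≠ 0, LowerSemicontinuousAt h x) :
    ∫⁻ x, h x ∂N ≤ liminf (fun k => (L (relBall (r k) e))⁻¹ * N (relBall (r k) e) *
      ∫⁻ x, h x ∂L) atTop := by
  have hm : ∀ k, Measurable fun x =>
      (L (relBall (r k) e))⁻¹ * ∫⁻ y in relBall (r k) x, h y ∂L := by
    intro k
    refine Measurable.const_mul ?_ _
    simp_rw [← lintegral_indicator (isOpen_relBall (r k) _).measurableSet]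
    exact (measurable_indicator_relBall (r k) hh).lintegral_prod_right'
  calc ∫⁻ x, h x ∂N ≤ ∫⁻ x, liminf (fun k =>
        (L (relBall (r k) e))⁻¹ * ∫⁻ y in relBall (r k) x, h y ∂L) atTop ∂N := by
        refine lintegral_mono_ae ?_
        filter_upwards [compl_mem_ae_iff.2 hN.zero] with x hx
        -- For `c < h x`, lower semicontinuity gives `h > c` on a metric ball about `x`. This ball
        -- contains `relBall (r k) x` once `r k ‖x‖` is below its radius, so the average of `h` over
        -- the relative ball is eventually at least `c`.
        refine le_of_forall_lt_imp_le_of_dense fun c hc => ?_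
        have hx' := norm_pos_iff.2 hx
        obtain ⟨δ, hδ, hball⟩ := Metric.eventually_nhds_iff_ball.1 (hl x hx c hc)
        have hev : ∀ᶠ k in atTop, r k < δ / ‖x‖ := hr0.eventually (gt_mem_nhds (by positivity))
        refine le_liminf_of_le (by isBoundedDefault) ?_
        filter_upwards [hev] with k hk
        have hsub : ∀ y ∈ relBall (r k) x, c ≤ h y := fun y hy => by
          refine (hball y (Metric.ball_subset_ball ?_ (relBall_subset_ball (hr k).le x hy))).le
          exact ((lt_div_iff₀ hx').1 hk).le
        calc c = (L (relBall (r k) e))⁻¹ * (c * L (relBall (r k) x)) := by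
              rw [hL.relBall_eq (r k) hx he, mul_comm c, ← mul_assoc,
                ENNReal.inv_mul_cancel (hL0 k) (hL.relBall_lt_top (hr k).le (hr' k) he).ne, one_mul]
          _ = (L (relBall (r k) e))⁻¹ * ∫⁻ _ in relBall (r k) x, c ∂L := by
              rw [setLIntegral_const]
          _ ≤ _ := mul_le_mul_right
              (setLIntegral_mono' (isOpen_relBall _ _).measurableSet hsub) _
    _ ≤ liminf (fun k => ∫⁻ x, (L (relBall (r k) e))⁻¹ * ∫⁻ y in relBall (r k) x, h y ∂L ∂N)
        atTop := lintegral_liminf_le hm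
    _ ≤ _ := by
        refine liminf_le_liminf (Eventually.of_forall fun k => ?_)
        rw [lintegral_const_mul' _ _ (ENNReal.inv_ne_top.2 (hL0 k)), mul_assoc]
        exact mul_le_mul_right (lintegral_relBall_comm hN _ he hh) _

/-- Two conformally invariant measures are proportional. -/
lemma ConfInvariant.lintegral_mul_le [NeZero n] {N L : Measure (E n)} [SFinite N] [SFinite L]
    (hN : ConfInvariant N) (hL : ConfInvariant L) (hN0 : N ≠ 0)
    (hLpos : ∀ U : Set (E n), IsOpen U → U.Nonempty → L U ≠ 0)
    {h h' : E n → ℝ≥0∞} (hh : Measurable h) (hl : ∀ x ≠ 0, LowerSemicontinuousAt h x)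
    (hh' : Measurable h') (hl' : ∀ x ≠ 0, LowerSemicontinuousAt h' x) :
    (∫⁻ x, h x ∂N) * ∫⁻ x, h' x ∂L ≤ (∫⁻ x, h x ∂L) * ∫⁻ x, h' x ∂N := by
  obtain ⟨e, he⟩ := exists_ne (0 : E n)
  let r : ℕ → ℝ := fun k => 1 / ((k : ℝ) + 2)
  have hr : ∀ k, 0 < r k := fun k => by positivity
  -- The shift by `2` in `r` serves this bound, which keeps the relative balls inside an annulus of
  -- finite measure.
  have hr' : ∀ k, r k ≤ 1 / 2 := fun k =>
    one_div_le_one_div_of_le two_pos (by linarith [(Nat.cast_nonneg k : (0 : ℝ) ≤ k)])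
  have hr0 : Tendsto r atTop (𝓝 0) := by
    have := (tendsto_add_atTop_iff_nat 2).2 (tendsto_one_div_atTop_nhds_zero_nat (𝕜 := ℝ))
    simpa [r] using this
  have hL0 : ∀ k, L (relBall (r k) e) ≠ 0 := fun k =>
    hLpos _ (isOpen_relBall _ _) ⟨e, mem_relBall_self (hr k) he⟩
  have hN0 : ∀ k, N (relBall (r k) e) ≠ 0 := fun k => hN.relBall_ne_zero hL hN0 he (hL0 k)
  have h1 := lintegral_le_liminf hN hL he hr hr' hr0 hL0 hh hl
  have h2 := lintegral_le_liminf hL hN he hr hr' hr0 hN0 hh' hl'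
  -- The ratio of the two measures on small relative balls need not be known to converge: the two
  -- estimates contain reciprocal ratios, which cancel for every `k` in the product.
  refine (mul_le_mul' h1 h2).trans (ENNReal.le_liminf_mul.trans ?_)
  refine (liminf_congr (Eventually.of_forall fun k => ?_)).trans_le
    (liminf_const ((∫⁻ x, h x ∂L) * ∫⁻ x, h' x ∂N)).le
  have e1 := ENNReal.mul_inv_cancel (hL0 k) (hL.relBall_lt_top (hr k).le (hr' k) he).ne
  have e2 := ENNReal.mul_inv_cancel (hN0 k) (hN.relBall_lt_top (hr k).le (hr' k) he).ne
  simp only [Pi.mul_apply]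
  generalize L (relBall (r k) e) = a at *
  generalize N (relBall (r k) e) = b at *
  calc _ = (a * a⁻¹) * (b * b⁻¹) * ((∫⁻ x, h x ∂L) * ∫⁻ x, h' x ∂N) := by ring
    _ = _ := by rw [e1, e2, one_mul, one_mul]

/-! ### Integration over all hyperplanes -/

/-- The action of a rotation on the unit sphere. -/
def sphereMap (U : E n ≃ₗᵢ[ℝ] E n) (ξ : Metric.sphere (0 : E n) 1) : Metric.sphere (0 : E n) 1 :=
  ⟨U ξ, by simp⟩

open scoped Pointwise in
lemma measurePreserving_sphereMap (U : E n ≃ₗᵢ[ℝ] E n) :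
    MeasurePreserving (sphereMap U) (volume : Measure (E n)).toSphere
      (volume : Measure (E n)).toSphere := by
  have hm : Measurable (sphereMap U) :=
    (U.continuous.comp continuous_subtype_val).measurable.subtype_mk
  refine ⟨hm, ?_⟩
  ext s hs
  have key : U ⁻¹' (Set.Ioo (0 : ℝ) 1 • (Subtype.val '' s)) =
      Set.Ioo (0 : ℝ) 1 • (Subtype.val '' (sphereMap U ⁻¹' s)) := by
    ext y
    simp only [Set.mem_smul, Set.mem_image, Set.mem_preimage]
    constructor
    · rintro ⟨c, hc, _, ⟨ξ, hξ, rfl⟩, h⟩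
      refine ⟨c, hc, _, ⟨sphereMap U.symm ξ, ?_, rfl⟩, ?_⟩
      · have : sphereMap U (sphereMap U.symm ξ) = ξ := Subtype.ext (U.apply_symm_apply _)
        rwa [this]
      · change c • U.symm (ξ : E n) = y
        rw [← U.symm.map_smul, h, U.symm_apply_apply]
    · rintro ⟨c, hc, _, ⟨ξ, hξ, rfl⟩, rfl⟩
      exact ⟨c, hc, _, ⟨sphereMap U ξ, hξ, rfl⟩, (U.map_smul c _).symm⟩
  rw [Measure.map_apply hm hs, Measure.toSphere_apply' _ (hm hs), Measure.toSphere_apply' _ hs,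
    ← key]
  congr 1
  exact U.measurePreserving.measure_preimage_equiv (f := U.toHomeomorph.toMeasurableEquiv) _

lemma measurePreserving_measureTS (U : E n ≃ₗᵢ[ℝ] E n) :
    MeasurePreserving (Prod.map U U) (measureTS n) (measureTS n) := by
  have hU := U.continuous.measurable
  refine ⟨hU.prodMap hU, ?_⟩
  have h1 := ((measurePreserving_sphereMap U).prod U.measurePreserving).restrict_preimage
    measurableSet_slabs
  have h2 : Prod.map (sphereMap U) U ⁻¹' {q | q.2 ∈ slab (q.1 : E n)} =
      {q | q.2 ∈ slab (q.1 : E n)} := by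
    ext q
    simp [slab, sphereMap]
  rw [h2] at h1
  have h3 : Prod.map U U ∘ (fun q : Metric.sphere (0 : E n) 1 × E n =>
      (projPerp (q.1 : E n) q.2, (q.1 : E n))) = (fun q : Metric.sphere (0 : E n) 1 × E n =>
      (projPerp (q.1 : E n) q.2, (q.1 : E n))) ∘ Prod.map (sphereMap U) U := by
    ext1 q
    simp [projPerp, sphereMap]
  conv_lhs => rw [measureTS]
  rw [Measure.map_map (hU.prodMap hU) continuous_toTS.measurable, h3,
    ← Measure.map_map continuous_toTS.measurable h1.measurable, h1.map_eq, measureTS]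

/-- The sum over all hyperplanes through the origin of their surface measures. -/
def hyperplaneMeasure (n : ℕ) : Measure (E n) := (measureTS n).map Prod.fst

instance : SFinite (hyperplaneMeasure n) := by unfold hyperplaneMeasure; infer_instance

lemma hyperplaneMeasure_apply {B : Set (E n)} (hB : MeasurableSet B) :
    hyperplaneMeasure n B = ∫⁻ ξ : Metric.sphere (0 : E n) 1,
      volume ((Subtype.val : (ℝ ∙ (ξ : E n))ᗮ → E n) ⁻¹' B)
        ∂((volume : Measure (E n)).toSphere) := by
  rw [hyperplaneMeasure, ← lintegral_indicator_one hB,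
    lintegral_map (measurable_one.indicator hB) measurable_fst,
    lintegral_measureTS (F := fun p => B.indicator 1 p.1)
      ((measurable_one.indicator hB).comp measurable_fst)]
  refine lintegral_congr fun ξ => ?_
  rw [← lintegral_indicator_one (measurable_subtype_coe hB)]
  rfl

lemma hyperplaneMeasure_map_isometry (U : E n ≃ₗᵢ[ℝ] E n) :
    (hyperplaneMeasure n).map U = hyperplaneMeasure n := by
  have hU := U.continuous.measurable
  rw [hyperplaneMeasure, Measure.map_map hU measurable_fst]
  conv_rhs => rw [← (measurePreserving_measureTS U).map_eq]
  rw [Measure.map_map measurable_fst (hU.prodMap hU)]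
  rfl

/-- Every hyperplane is stable under dilation and carries Lebesgue measure of dimension `n - 1`. -/
lemma hyperplaneMeasure_map_dilation {c : ℝ} (hc : 0 < c) :
    (hyperplaneMeasure n).map (fun y => c • y) =
      ENNReal.ofReal (c ^ (n - 1))⁻¹ • hyperplaneMeasure n := by
  have hm : Measurable fun y : E n => c • y := by fun_prop
  ext B hB
  rw [Measure.map_apply hm hB, Measure.smul_apply, hyperplaneMeasure_apply (hm hB),
    hyperplaneMeasure_apply hB, smul_eq_mul, ← lintegral_const_mul' _ _ ENNReal.ofReal_ne_top]
  refine lintegral_congr fun ξ => ?_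
  have := Measure.addHaar_preimage_smul (volume : Measure (ℝ ∙ (ξ : E n))ᗮ) hc.ne'
    ((Subtype.val : (ℝ ∙ (ξ : E n))ᗮ → E n) ⁻¹' B)
  rw [finrank_perp (norm_sphere ξ), abs_of_pos (by positivity)] at this
  rw [← this]
  rfl

lemma hyperplaneMeasure_singleton_zero (hn : 2 ≤ n) : hyperplaneMeasure n {0} = 0 := by
  have h := ae_measureTS_ne_zero hn
  rw [ae_iff] at h
  rw [hyperplaneMeasure, Measure.map_apply measurable_fst (measurableSet_singleton 0)]
  simp only [not_not] at h
  exact h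

/-- Each hyperplane meets the ball in a unit ball of dimension `n - 1`, of volume independent of
`ξ`; the other factor is the area of the sphere. -/
lemma hyperplaneMeasure_ball (hn : 2 ≤ n) : hyperplaneMeasure n (Metric.ball 0 1) =
    ENNReal.ofReal (√Real.pi ^ (n - 1) / Real.Gamma ((n - 1 : ℕ) / 2 + 1)) *
      (n * volume (Metric.ball (0 : E n) 1)) := by
  have : NeZero n := ⟨by omega⟩
  rw [hyperplaneMeasure_apply Metric.isOpen_ball.measurableSet]
  have : ∀ ξ : Metric.sphere (0 : E n) 1,
      volume ((Subtype.val : (ℝ ∙ (ξ : E n))ᗮ → E n) ⁻¹' Metric.ball 0 1) =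
      ENNReal.ofReal (√Real.pi ^ (n - 1) / Real.Gamma ((n - 1 : ℕ) / 2 + 1)) := by
    intro ξ
    have hd := finrank_perp (norm_sphere ξ)
    have : Nontrivial (ℝ ∙ (ξ : E n))ᗮ := Module.nontrivial_of_finrank_pos (R := ℝ) (by omega)
    have h := InnerProductSpace.volume_ball (0 : (ℝ ∙ (ξ : E n))ᗮ) 1
    rw [hd, ENNReal.ofReal_one, one_pow, one_mul] at h
    rw [← h]
    congr 1
  simp_rw [this]
  rw [lintegral_const, Measure.toSphere_apply_univ, finrank_euclideanSpace_fin]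

/-- A density which compensates the distortion of a measure makes the measure invariant. -/
lemma map_withDensity_of_map {N : Measure (E n)} {g : E n → E n} (hg : Measurable g)
    {d : E n → ℝ≥0∞} (hd : Measurable d) {k k' : ℝ≥0∞} (hk : k * k' = 1) (hk' : k ≠ ⊤)
    (hdg : ∀ y, d y = k * d (g y)) (hN : N.map g = k' • N) :
    (N.withDensity d).map g = N.withDensity d := by
  ext B hB
  rw [Measure.map_apply hg hB, withDensity_apply _ (hg hB), withDensity_apply _ hB]
  calc ∫⁻ y in g ⁻¹' B, d y ∂N = k * ∫⁻ y in g ⁻¹' B, d (g y) ∂N := by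
        rw [← lintegral_const_mul' _ _ hk']
        exact lintegral_congr fun y => hdg y
    _ = k * ∫⁻ y in B, d y ∂(N.map g) := by rw [setLIntegral_map hB hd hg]
    _ = _ := by rw [hN, Measure.restrict_smul, lintegral_smul_measure, smul_eq_mul, ← mul_assoc,
        hk, one_mul]

/-- A rotation invariant measure, homogeneous of degree `m`, is made conformally invariant by the
density `|y|^{-m}`. -/
lemma confInvariant_withDensity {N : Measure (E n)} (m : ℕ)
    (h1 : ∀ U : E n ≃ₗᵢ[ℝ] E n, N.map U = N)
    (h2 : ∀ c : ℝ, 0 < c → N.map (fun y => c • y) = ENNReal.ofReal (c ^ m)⁻¹ • N)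
    (h3 : N {0} = 0) (h4 : ∀ R : ℝ, N (Metric.closedBall 0 R) < ⊤) :
    ConfInvariant (N.withDensity fun y => (‖y‖ₑ ^ m)⁻¹) where
  isometry U := map_withDensity_of_map (k := 1) (k' := 1) U.continuous.measurable (by fun_prop)
    (one_mul 1) ENNReal.one_ne_top (fun y => by simp [enorm]) (by rw [h1, one_smul])
  dilation c hc := by
    refine map_withDensity_of_map (by fun_prop) (by fun_prop) (k := ENNReal.ofReal (c ^ m)) ?_
      ENNReal.ofReal_ne_top (fun y => ?_) (h2 c hc)
    · rw [← ENNReal.ofReal_mul (by positivity), mul_inv_cancel₀ (by positivity),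
        ENNReal.ofReal_one]
    · have hc' : ENNReal.ofReal (c ^ m) ≠ 0 := (ENNReal.ofReal_pos.2 (by positivity)).ne'
      rw [enorm_smul, mul_pow, Real.enorm_of_nonneg hc.le, ← ENNReal.ofReal_pow hc.le,
        ENNReal.mul_inv (Or.inl hc') (Or.inl ENNReal.ofReal_ne_top), ← mul_assoc,
        ENNReal.mul_inv_cancel hc' ENNReal.ofReal_ne_top, one_mul]
  zero := withDensity_absolutelyContinuous _ _ h3
  finite r R hr := by
    rw [withDensity_apply _ (Metric.isClosed_closedBall.measurableSet.diff
      Metric.isOpen_ball.measurableSet)]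
    calc _ ≤ ∫⁻ y in Metric.closedBall 0 R \ Metric.ball 0 r, (ENNReal.ofReal r ^ m)⁻¹ ∂N := by
          refine setLIntegral_mono' (Metric.isClosed_closedBall.measurableSet.diff
            Metric.isOpen_ball.measurableSet) fun y hy => ?_
          have : r ≤ ‖y‖ := by simpa using hy.2
          rw [← ofReal_norm]
          gcongr
      _ < ⊤ := by
          rw [setLIntegral_const]
          refine ENNReal.mul_lt_top ?_ ((measure_mono Set.sdiff_subset).trans_lt (h4 R))
          rw [ENNReal.inv_lt_top]
          exact ENNReal.pow_pos (ENNReal.ofReal_pos.2 hr) m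

lemma a_pos (hn : 2 ≤ n) : 0 < a n := by
  have h2 : (2 : ℝ) ≤ n := by exact_mod_cast hn
  have := Real.Gamma_pos_of_pos (s := ((n : ℝ) - 1) / 2) (by linarith)
  unfold a
  positivity

/-- Polar coordinates: the radial factor is `∫₀¹ r^(n-2) dr = 1/(n-1)`. With
`hyperplaneMeasure_ball`, this calibrates the proportionality constant. -/
lemma lintegral_ball_inv_norm (hn : 2 ≤ n) :
    ∫⁻ y in Metric.ball (0 : E n) 1, ‖y‖ₑ⁻¹ =
      ENNReal.ofReal ((n - 1 : ℝ)⁻¹) * (n * volume (Metric.ball (0 : E n) 1)) := by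
  have : NeZero n := ⟨by omega⟩
  have hn1 : (1 : ℝ) < n := by exact_mod_cast hn
  let f : ℝ → ℝ := (Set.Iio 1).indicator fun r => r⁻¹
  have hg : ∀ r ∈ Set.Ioi (0 : ℝ), r ^ (n - 1) • f r =
      (Set.Iio 1).indicator (fun r => r ^ (n - 2)) r := by
    intro r hr
    by_cases h1 : r < 1
    · have hs : n - 1 = (n - 2) + 1 := by omega
      have hr0 : r ≠ 0 := ne_of_gt hr
      simp only [f, Set.indicator_of_mem (Set.mem_Iio.2 h1), smul_eq_mul]
      rw [hs, pow_succ, mul_assoc, mul_inv_cancel₀ hr0, mul_one]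
    · simp [f, h1]
  have hio : IntegrableOn (fun r : ℝ => (Set.Iio 1).indicator (fun r => r ^ (n - 2)) r)
      (Set.Ioi 0) := by
    rw [IntegrableOn, integrable_indicator_iff measurableSet_Iio, IntegrableOn,
      Measure.restrict_restrict measurableSet_Iio, Set.inter_comm, Set.Ioi_inter_Iio]
    exact ((continuous_pow (n - 2)).continuousOn.integrableOn_Icc
      (a := 0) (b := 1)).mono_set Set.Ioo_subset_Icc_self
  have hi : Integrable fun y : E n => f ‖y‖ := by
    rw [integrable_fun_norm_addHaar, finrank_euclideanSpace_fin]
    exact hio.congr_fun (fun r hr => (hg r hr).symm) measurableSet_Ioi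
  have hint : ∫ y : E n, f ‖y‖ = (n - 1 : ℝ)⁻¹ * (n * volume.real (Metric.ball (0 : E n) 1)) := by
    rw [integral_fun_norm_addHaar, finrank_euclideanSpace_fin,
      setIntegral_congr_fun measurableSet_Ioi hg, setIntegral_indicator measurableSet_Iio,
      Set.Ioi_inter_Iio, ← integral_Ioc_eq_integral_Ioo,
      ← intervalIntegral.integral_of_le zero_le_one, integral_pow]
    have : ((n - 2 : ℕ) : ℝ) + 1 = n - 1 := by
      rw [Nat.cast_sub hn]; push_cast; ring
    rw [this]
    simp
    ring
  have hf0 : ∀ y : E n, 0 ≤ f ‖y‖ := fun y =>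
    Set.indicator_apply_nonneg fun _ => by positivity
  have h1 := ofReal_integral_eq_lintegral_ofReal hi (Eventually.of_forall hf0)
  rw [hint, ENNReal.ofReal_mul (by simp [hn1.le]), ENNReal.ofReal_mul (by positivity),
    ENNReal.ofReal_natCast, ofReal_measureReal (by finiteness)] at h1
  rw [h1, ← lintegral_indicator Metric.isOpen_ball.measurableSet]
  refine lintegral_congr_ae ?_
  filter_upwards [compl_mem_ae_iff.2 (measure_singleton (0 : E n))] with y hy
  by_cases hb : ‖y‖ < 1
  · rw [Set.indicator_of_mem (by simpa using hb)]
    simp only [f, Set.indicator_of_mem (Set.mem_Iio.2 hb)]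
    rw [ENNReal.ofReal_inv_of_pos (norm_pos_iff.2 hy), ofReal_norm]
  · rw [Set.indicator_of_notMem (by simpa using hb)]
    simp [f, hb]

/-- Integration over all hyperplanes with weight `|y|` is integration over the space, up to a
constant. -/
theorem lintegral_eq_hyperplaneMeasure (hn : 2 ≤ n) {F : E n → ℝ} (hF : Measurable F)
    (hc : ∀ x ≠ 0, ContinuousAt F x) :
    ∫⁻ y, ENNReal.ofReal (F y) = ENNReal.ofReal (a n) *
      ∫⁻ y, ‖y‖ₑ * ENNReal.ofReal (F y) ∂hyperplaneMeasure n := by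
  have : NeZero n := ⟨by omega⟩
  set N := (hyperplaneMeasure n).withDensity fun y => (‖y‖ₑ ^ (n - 1))⁻¹ with hN
  set L := (volume : Measure (E n)).withDensity fun y => (‖y‖ₑ ^ n)⁻¹ with hL
  have hNi : ConfInvariant N := confInvariant_withDensity (n - 1) hyperplaneMeasure_map_isometry
    (fun c hc => hyperplaneMeasure_map_dilation hc) (hyperplaneMeasure_singleton_zero hn)
    (fun R => by
      rw [hyperplaneMeasure, Measure.map_apply measurable_fst Metric.isClosed_closedBall.measurableSet]
      exact measureTS_closedBall_lt_top R)
  have hLi : ConfInvariant L := confInvariant_withDensity n (fun U => U.measurePreserving.map_eq)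
    (fun c hc => by
      rw [Measure.map_addHaar_smul _ hc.ne', finrank_euclideanSpace_fin, abs_of_pos (by positivity)])
    (measure_singleton 0) (fun R => measure_closedBall_lt_top)
  -- The power `‖y‖ⁿ` cancels the density of `L` and leaves one factor `‖y‖` against the density of
  -- `N`. The reference function `k'` cancels the density of `N` instead, and so reduces to two
  -- known integrals over the unit ball; as a nonnegative function cut off to an open set it is
  -- lower semicontinuous.
  let k : E n → ℝ≥0∞ := fun y => ENNReal.ofReal (‖y‖ ^ n * F y)
  let k' : E n → ℝ≥0∞ := (Metric.ball 0 1).indicator fun y => ‖y‖ₑ ^ (n - 1)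
  have hk : Measurable k := by fun_prop
  have hk' : Measurable k' :=
    (by fun_prop : Measurable fun y : E n => ‖y‖ₑ ^ (n - 1)).indicator
      Metric.isOpen_ball.measurableSet
  have hkl : ∀ x ≠ 0, LowerSemicontinuousAt k x := fun x hx =>
    ContinuousAt.lowerSemicontinuousAt
      (ENNReal.continuous_ofReal.continuousAt.comp
        ((by fun_prop : ContinuousAt (fun y : E n => ‖y‖ ^ n) x).mul (hc x hx)))
  have hkl' : ∀ x ≠ 0, LowerSemicontinuousAt k' x := by
    intro x _
    by_cases hb : x ∈ Metric.ball (0 : E n) 1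
    · have he : k' =ᶠ[𝓝 x] fun y => ‖y‖ₑ ^ (n - 1) := by
        filter_upwards [Metric.isOpen_ball.mem_nhds hb] with y hy
        exact Set.indicator_of_mem hy _
      exact ContinuousAt.lowerSemicontinuousAt
        ((by fun_prop : ContinuousAt (fun y : E n => ‖y‖ₑ ^ (n - 1)) x).congr he.symm)
    · intro c hc
      simp [k', Set.indicator_of_notMem hb] at hc
  have hν0 : ∀ᵐ y ∂hyperplaneMeasure n, y ≠ 0 :=
    compl_mem_ae_iff.2 (hyperplaneMeasure_singleton_zero hn)
  have hv0 : ∀ᵐ y ∂(volume : Measure (E n)), y ≠ 0 :=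
    compl_mem_ae_iff.2 (measure_singleton 0)
  have hinv : ∀ (m : ℕ) (y : E n), y ≠ 0 → (‖y‖ₑ ^ m)⁻¹ * ‖y‖ₑ ^ m = 1 := fun m y hy =>
    ENNReal.inv_mul_cancel (pow_ne_zero _ (by simpa using hy)) (by finiteness)
  have hpow : ∀ y : E n, ‖y‖ₑ ^ n = ‖y‖ₑ ^ (n - 1) * ‖y‖ₑ := fun y => by
    rw [← pow_succ]; congr 1; omega
  have hkk : ∀ y, k y = ‖y‖ₑ ^ n * ENNReal.ofReal (F y) := fun y => by
    rw [← ofReal_norm, ← ENNReal.ofReal_pow (norm_nonneg _), ← ENNReal.ofReal_mul (by positivity)]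
  have e1 : ∫⁻ y, k y ∂N = ∫⁻ y, ‖y‖ₑ * ENNReal.ofReal (F y) ∂hyperplaneMeasure n := by
    rw [hN, lintegral_withDensity_eq_lintegral_mul _ (by fun_prop) hk]
    refine lintegral_congr_ae ?_
    filter_upwards [hν0] with y hy
    rw [Pi.mul_apply, hkk, hpow, mul_assoc, ← mul_assoc, hinv _ y hy, one_mul]
  have e2 : ∫⁻ y, k y ∂L = ∫⁻ y, ENNReal.ofReal (F y) := by
    rw [hL, lintegral_withDensity_eq_lintegral_mul _ (by fun_prop) hk]
    refine lintegral_congr_ae ?_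
    filter_upwards [hv0] with y hy
    rw [Pi.mul_apply, hkk, ← mul_assoc, hinv _ y hy, one_mul]
  have e3 : ∫⁻ y, k' y ∂N = hyperplaneMeasure n (Metric.ball 0 1) := by
    rw [hN, lintegral_withDensity_eq_lintegral_mul _ (by fun_prop) hk',
      ← lintegral_indicator_one Metric.isOpen_ball.measurableSet]
    refine lintegral_congr_ae ?_
    filter_upwards [hν0] with y hy
    by_cases hb : y ∈ Metric.ball (0 : E n) 1
    · simp only [Pi.mul_apply, k', Set.indicator_of_mem hb, hinv _ y hy, Pi.one_apply]
    · simp only [Pi.mul_apply, k', Set.indicator_of_notMem hb, mul_zero]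
  have e4 : ∫⁻ y, k' y ∂L = ∫⁻ y in Metric.ball (0 : E n) 1, ‖y‖ₑ⁻¹ := by
    rw [hL, lintegral_withDensity_eq_lintegral_mul _ (by fun_prop) hk',
      ← lintegral_indicator Metric.isOpen_ball.measurableSet]
    refine lintegral_congr_ae ?_
    filter_upwards [hv0] with y hy
    by_cases hb : y ∈ Metric.ball (0 : E n) 1
    · simp only [Pi.mul_apply, k', Set.indicator_of_mem hb]
      rw [hpow, ENNReal.mul_inv (Or.inr (by finiteness)) (Or.inl (by finiteness)), mul_right_comm,
        hinv _ y hy, one_mul]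
    · simp only [Pi.mul_apply, k', Set.indicator_of_notMem hb, mul_zero]
  set V : ℝ≥0∞ := n * volume (Metric.ball (0 : E n) 1) with hV
  have hV0 : V ≠ 0 := mul_ne_zero (by exact_mod_cast (NeZero.ne n))
    (Metric.measure_ball_pos volume _ one_pos).ne'
  have hVt : V ≠ ⊤ := ENNReal.mul_ne_top (by finiteness) measure_ball_lt_top.ne
  set v : ℝ := √Real.pi ^ (n - 1) / Real.Gamma ((n - 1 : ℕ) / 2 + 1) with hv
  have hvpos : 0 < v := div_pos (by positivity) (Real.Gamma_pos_of_pos (by positivity))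
  rw [hyperplaneMeasure_ball hn] at e3
  rw [lintegral_ball_inv_norm hn] at e4
  have hN0 : N ≠ 0 := by
    intro h0
    rw [h0, lintegral_zero_measure] at e3
    exact mul_ne_zero (ENNReal.ofReal_pos.2 hvpos).ne' hV0 e3.symm
  have hLpos : ∀ U : Set (E n), IsOpen U → U.Nonempty → L U ≠ 0 := by
    intro U hU hne h0
    rw [hL, withDensity_apply_eq_zero (by fun_prop)] at h0
    refine hU.measure_ne_zero volume hne ?_
    convert h0
    ext y
    simp [ENNReal.inv_eq_zero]
  -- Exchanging the roles of `k` and `k'` gives the reverse inequality.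
  have key := le_antisymm (hNi.lintegral_mul_le hLi hN0 hLpos hk hkl hk' hkl')
    ((mul_comm _ _).trans_le
      ((hNi.lintegral_mul_le hLi hN0 hLpos hk' hkl' hk hkl).trans_eq (mul_comm _ _)))
  rw [e1, e2, e3, e4] at key
  have hn1 : (0 : ℝ) < (n : ℝ) - 1 := by
    have : (2 : ℝ) ≤ n := by exact_mod_cast hn
    linarith
  -- Here `v` is the volume of the unit ball in dimension `n - 1`; the area `V` of the sphere occurs
  -- on both sides of `key` and drops out.
  have hav : a n = (n - 1 : ℝ)⁻¹ * v⁻¹ := by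
    have hG := (Real.Gamma_pos_of_pos (half_pos hn1)).ne'
    rw [hv, a, Nat.cast_sub (by omega), Nat.cast_one, Real.Gamma_add_one (by positivity),
      Real.sqrt_eq_rpow, ← Real.rpow_natCast, ← Real.rpow_mul Real.pi_pos.le,
      Nat.cast_sub (by omega), Nat.cast_one, one_div_mul_eq_div]
    have : Real.pi ^ (((n : ℝ) - 1) / 2) ≠ 0 := by positivity
    field_simp
  have hV1 := ENNReal.mul_inv_cancel hV0 hVt
  have hv1 : ENNReal.ofReal v * ENNReal.ofReal v⁻¹ = 1 := by
    rw [← ENNReal.ofReal_mul hvpos.le, mul_inv_cancel₀ hvpos.ne', ENNReal.ofReal_one]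
  rw [hav, ENNReal.ofReal_mul (by positivity)]
  generalize ∫⁻ y, ENNReal.ofReal (F y) = I at *
  generalize ∫⁻ y, ‖y‖ₑ * ENNReal.ofReal (F y) ∂hyperplaneMeasure n = J at *
  calc I = I * (ENNReal.ofReal v * V) * (V⁻¹ * ENNReal.ofReal v⁻¹) := by
        rw [show I * (ENNReal.ofReal v * V) * (V⁻¹ * ENNReal.ofReal v⁻¹) =
          I * (ENNReal.ofReal v * ENNReal.ofReal v⁻¹) * (V * V⁻¹) by ring, hV1, hv1, mul_one,
          mul_one]
    _ = J * ENNReal.ofReal ((n - 1 : ℝ)⁻¹) * ENNReal.ofReal v⁻¹ * (V * V⁻¹) := by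
        rw [← key]; ring
    _ = _ := by rw [hV1]; ring

/-! ### Fourier transforms of Schwartz functions -/

lemma fourierE_eq (φ : 𝓢(E n, ℂ)) (y : E n) :
    fourierE φ y = (((2 * Real.pi) ^ (-(n : ℝ) / 2) : ℝ) : ℂ) * 𝓕 φ ((2 * Real.pi)⁻¹ • y) := by
  rw [fourierE, SchwartzMap.fourier_coe, Real.fourier_eq']
  congr 1
  refine integral_congr_ae (Eventually.of_forall fun x => ?_)
  simp only [smul_eq_mul]
  congr 2
  rw [real_inner_smul_right, real_inner_comm]
  have : (Real.pi : ℂ) ≠ 0 := by exact_mod_cast Real.pi_ne_zero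
  push_cast
  field_simp

lemma continuous_fourierE (φ : 𝓢(E n, ℂ)) : Continuous fun y => fourierE φ y := by
  obtain ⟨ψ, hψ⟩ := fourierE_schwartz φ
  simp_rw [hψ]
  exact ψ.continuous

lemma fourierE_sub (φ ψ : 𝓢(E n, ℂ)) (y : E n) :
    fourierE (⇑(φ - ψ)) y = fourierE φ y - fourierE ψ y := by
  rw [sub_eq_add_neg, fourierE_add, fourierE_neg, sub_eq_add_neg]

lemma fourierE_smul (c : ℂ) (φ : 𝓢(E n, ℂ)) (y : E n) :
    fourierE (⇑(c • φ)) y = c * fourierE φ y := by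
  simp only [fourierE, _root_.smul_apply, smul_eq_mul, mul_left_comm _ c]
  rw [integral_const_mul]
  ring

lemma fourierE_sum {ι : Type*} (s : Finset ι) (φ : ι → 𝓢(E n, ℂ)) (y : E n) :
    fourierE (⇑(∑ j ∈ s, φ j)) y = ∑ j ∈ s, fourierE (φ j) y := by
  classical
  induction s using Finset.induction_on with
  | empty => simp [fourierE]
  | insert j s hj ih => rw [Finset.sum_insert hj, Finset.sum_insert hj, fourierE_add, ih]

open LineDeriv in
lemma fourierE_lineDeriv (φ : 𝓢(E n, ℂ)) (v y : E n) :
    fourierE (∂_{v} φ : 𝓢(E n, ℂ)) y = Complex.I * (⟪y, v⟫_ℝ : ℝ) * fourierE φ y := by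
  rw [fourierE_eq, fourierE_eq, SchwartzMap.fourier_lineDerivOp_eq, _root_.smul_apply,
    SchwartzMap.smulLeftCLM_apply_apply (Function.hasTemperateGrowth_inner_left v), real_inner_smul_left]
  have : (Real.pi : ℂ) ≠ 0 := by exact_mod_cast Real.pi_ne_zero
  simp only [smul_eq_mul, Complex.real_smul]
  push_cast
  field_simp

/-- Multiplication of a Schwartz function by the linear function `⟨v, ·⟩`. -/
def mulInner (v : E n) (φ : 𝓢(E n, ℂ)) : 𝓢(E n, ℂ) :=
  SchwartzMap.smulLeftCLM ℂ (fun z : E n => ⟪v, z⟫_ℝ) φ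

lemma mulInner_apply (v : E n) (φ : 𝓢(E n, ℂ)) (z : E n) :
    mulInner v φ z = (⟪v, z⟫_ℝ : ℝ) * φ z := by
  rw [mulInner, SchwartzMap.smulLeftCLM_apply_apply (Function.hasTemperateGrowth_inner_right v),
    Complex.real_smul]

open LineDeriv in
lemma lineDeriv_mulInner (v w : E n) (φ : 𝓢(E n, ℂ)) (z : E n) :
    (∂_{w} (mulInner v φ) : 𝓢(E n, ℂ)) z = (⟪v, w⟫_ℝ : ℝ) * φ z + (⟪v, z⟫_ℝ : ℝ) * fderiv ℝ φ z w := by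
  rw [SchwartzMap.lineDerivOp_apply_eq_fderiv]
  have h : (⇑(mulInner v φ) : E n → ℂ) = fun z => (⟪v, z⟫_ℝ : ℝ) • φ z := by
    funext z
    rw [mulInner_apply, Complex.real_smul]
  have h1 : HasFDerivAt (fun z : E n => ⟪v, z⟫_ℝ) (innerSL ℝ v) z :=
    (innerSL ℝ v).hasFDerivAt
  rw [h, (h1.fun_smul (φ.hasFDerivAt z)).fderiv]
  simp [add_comm]

/-! ### The Fourier slice theorem -/

/-- The component of a vector field in the direction `ξ`. -/
def dirComp (f : Fin n → 𝓢(E n, ℂ)) (ξ : E n) : 𝓢(E n, ℂ) := ∑ j, ((ξ j : ℝ) : ℂ) • f j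

lemma dirComp_apply (f : Fin n → 𝓢(E n, ℂ)) (ξ z : E n) :
    dirComp f ξ z = ∑ j, f j z * ((ξ j : ℝ) : ℂ) := by
  simp [dirComp, mul_comm]

/-- The Fourier transform on `ξ^⊥` of a function integrated along the lines parallel to `ξ`. -/
lemma fourierTS_of_ray {φ : E n × E n → ℂ} (h : 𝓢(E n, ℂ)) {y ξ : E n} (hξ : ‖ξ‖ = 1)
    (hy : ⟪y, ξ⟫_ℝ = 0) (hφ : ∀ x : (ℝ ∙ ξ)ᗮ, φ (x, ξ) = ∫ τ : ℝ, h (x + τ • ξ)) :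
    fourierTS φ (y, ξ) = (√(2 * Real.pi) : ℂ) * fourierE h y := by
  have hP := measurePreserving_add_smul hξ
  have hi : Integrable fun x : E n => Complex.exp (-(Complex.I * ((⟪y, x⟫_ℝ : ℝ) : ℂ))) * h x := by
    refine h.integrable.bdd_mul (c := 1) (by fun_prop) (Eventually.of_forall fun x => ?_)
    rw [Complex.norm_exp]; simp
  have h1 := integral_map (μ := (volume : Measure (ℝ ∙ ξ)ᗮ).prod (volume : Measure ℝ))
    hP.measurable.aemeasurable (hP.map_eq.symm ▸ hi.1)
  rw [hP.map_eq] at h1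
  rw [fourierTS, fourierE, h1.trans (integral_prod _ (hP.integrable_comp_of_integrable hi)), ← mul_assoc]
  congr 1
  · have hp : (0 : ℝ) < 2 * Real.pi := by positivity
    rw [Real.sqrt_eq_rpow, ← Complex.ofReal_mul, ← Real.rpow_add hp]
    congr 2
    ring
  · refine integral_congr_ae (Eventually.of_forall fun x => ?_)
    simp only
    rw [hφ, ← integral_const_mul]
    refine integral_congr_ae (Eventually.of_forall fun τ => ?_)
    simp only
    rw [inner_add_right, real_inner_smul_right, hy, mul_zero, add_zero]

lemma fourierTS_momentRay_zero (f : Fin n → 𝓢(E n, ℂ)) {y ξ : E n} (hξ : ‖ξ‖ = 1)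
    (hy : ⟪y, ξ⟫_ℝ = 0) :
    fourierTS (momentRay 0 f) (y, ξ) = (√(2 * Real.pi) : ℂ) * fourierE (dirComp f ξ) y := by
  refine fourierTS_of_ray _ hξ hy fun x => ?_
  simp [momentRay, dirComp_apply]

lemma fourierTS_momentRay_one (f : Fin n → 𝓢(E n, ℂ)) {y ξ : E n} (hξ : ‖ξ‖ = 1)
    (hy : ⟪y, ξ⟫_ℝ = 0) : fourierTS (momentRay 1 f) (y, ξ) =
      (√(2 * Real.pi) : ℂ) * fourierE (mulInner ξ (dirComp f ξ)) y := by
  refine fourierTS_of_ray _ hξ hy fun x => ?_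
  simp only [momentRay, dirComp_apply, mulInner_apply, inner_add_smul hξ, pow_one]

/-! ### The derivatives `Ξᵢ` of the ray transform -/

/-- The integrand of the ray transform along the line through `p.1` with direction `p.2`. -/
def rayIntegrand (f : Fin n → 𝓢(E n, ℂ)) (p : E n × E n) (τ : ℝ) : ℂ :=
  ∑ j, f j (p.1 + τ • p.2) * ((p.2 j : ℝ) : ℂ)

/-- For `ξ ≠ 0`, the ray transform of order zero depends on the oriented line only. -/
lemma extendTS_momentRay_zero (f : Fin n → 𝓢(E n, ℂ)) {p : E n × E n} (hp : p.2 ≠ 0) :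
    extendTS (momentRay 0 f) p = ∫ τ, rayIntegrand f p τ := by
  have hp' := norm_pos_iff.2 hp
  set c := ⟪p.2, p.1⟫_ℝ / ‖p.2‖ ^ 2
  -- Projecting the base point and normalizing the direction is an affine reparametrization of the
  -- same line. The factor `‖p.2‖⁻¹` from the normalized direction in `⟨f, ξ⟩` compensates the
  -- change of variable.
  have h1 : ∀ τ : ℝ, (τ : ℂ) ^ 0 * ∑ i, f i (p.1 - c • p.2 + τ • ‖p.2‖⁻¹ • p.2) *
      (((‖p.2‖⁻¹ • p.2) i : ℝ) : ℂ) = ‖p.2‖⁻¹ • rayIntegrand f p (‖p.2‖⁻¹ * τ - c) := by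
    intro τ
    rw [rayIntegrand, pow_zero, one_mul, Finset.smul_sum]
    refine Finset.sum_congr rfl fun j _ => ?_
    rw [show p.1 - c • p.2 + τ • ‖p.2‖⁻¹ • p.2 = p.1 + (‖p.2‖⁻¹ * τ - c) • p.2 by
      rw [sub_smul, smul_smul, mul_comm τ]; abel]
    simp only [PiLp.smul_apply, smul_eq_mul, Complex.real_smul]
    push_cast
    ring
  rw [extendTS, momentRay, integral_congr_ae (Eventually.of_forall h1), integral_smul, Measure.integral_comp_mul_left (fun s => rayIntegrand f p (s - c)),
    integral_sub_right_eq_self (rayIntegrand f p) c, inv_inv, abs_of_pos hp', smul_smul,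
    inv_mul_cancel₀ hp'.ne', one_smul]

/-- The evaluation `(x, ξ) ↦ x + τξ`. -/
def linePoint (n : ℕ) (τ : ℝ) : E n × E n →L[ℝ] E n :=
  ContinuousLinearMap.fst ℝ (E n) (E n) + τ • ContinuousLinearMap.snd ℝ (E n) (E n)

lemma linePoint_apply (τ : ℝ) (p : E n × E n) : linePoint n τ p = p.1 + τ • p.2 := rfl

/-- The coordinate `ξⱼ` as a complex number. -/
def dirCoord (j : Fin n) : E n × E n →L[ℝ] ℂ :=
  Complex.ofRealCLM ∘L (EuclideanSpace.proj j : E n →L[ℝ] ℝ) ∘L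
    ContinuousLinearMap.snd ℝ (E n) (E n)

lemma dirCoord_apply (j : Fin n) (p : E n × E n) : dirCoord j p = ((p.2 j : ℝ) : ℂ) := rfl

/-- The derivative of the integrand of the ray transform. -/
def rayDeriv (f : Fin n → 𝓢(E n, ℂ)) (p : E n × E n) (τ : ℝ) : E n × E n →L[ℝ] ℂ :=
  ∑ j, (f j (p.1 + τ • p.2) • dirCoord j +
    ((p.2 j : ℝ) : ℂ) • (fderiv ℝ (f j) (p.1 + τ • p.2)) ∘L linePoint n τ)

lemma hasFDerivAt_rayIntegrand (f : Fin n → 𝓢(E n, ℂ)) (p : E n × E n) (τ : ℝ) :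
    HasFDerivAt (fun p => rayIntegrand f p τ) (rayDeriv f p τ) p := by
  unfold rayIntegrand rayDeriv
  refine HasFDerivAt.fun_sum fun j _ => ?_
  have h1 : HasFDerivAt (fun p : E n × E n => f j (p.1 + τ • p.2))
      ((fderiv ℝ (f j) (p.1 + τ • p.2)) ∘L linePoint n τ) p :=
    ((f j).hasFDerivAt (p.1 + τ • p.2)).comp p (linePoint n τ).hasFDerivAt
  exact h1.mul (dirCoord j).hasFDerivAt

lemma norm_linePoint_le (τ : ℝ) : ‖linePoint n τ‖ ≤ 1 + |τ| := by
  refine (norm_add_le _ _).trans (add_le_add (ContinuousLinearMap.norm_fst_le ..) ?_)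
  rw [norm_smul, Real.norm_eq_abs]
  exact mul_le_of_le_one_right (abs_nonneg τ) (ContinuousLinearMap.norm_snd_le ..)

lemma norm_dirCoord_le (j : Fin n) : ‖(dirCoord j : E n × E n →L[ℝ] ℂ)‖ ≤ 1 := by
  refine ContinuousLinearMap.opNorm_le_bound _ zero_le_one fun p => ?_
  rw [dirCoord_apply, Complex.norm_real, one_mul]
  exact (PiLp.norm_apply_le p.2 j).trans (norm_snd_le p)

/-- Along lines with directions bounded away from zero a Schwartz function and its derivative
decay uniformly. -/
lemma exists_decay (φ : 𝓢(E n, ℂ)) (R : ℝ) (hR : 0 ≤ R) : ∃ C : ℝ, 0 ≤ C ∧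
    ∀ (p : E n × E n) (τ : ℝ), ‖p.1‖ ≤ R → 1 / 2 ≤ ‖p.2‖ →
      ‖φ (p.1 + τ • p.2)‖ ≤ C * (1 + |τ|) ^ (-3 : ℤ) ∧
      ‖fderiv ℝ φ (p.1 + τ • p.2)‖ ≤ C * (1 + |τ|) ^ (-3 : ℤ) := by
  let S : ℝ := 2 ^ 3 * ((Finset.Iic (3, 1)).sup fun m => SchwartzMap.seminorm ℝ m.1 m.2) φ
  have hS : 0 ≤ S := by positivity
  have h0 : ∀ z, (1 + ‖z‖) ^ 3 * ‖φ z‖ ≤ S := fun z => by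
    have := SchwartzMap.one_add_le_sup_seminorm_apply (𝕜 := ℝ) (m := (3, 1)) (k := 3) (n := 0)
      le_rfl zero_le_one φ z
    rwa [norm_iteratedFDeriv_zero] at this
  have h1 : ∀ z, (1 + ‖z‖) ^ 3 * ‖fderiv ℝ φ z‖ ≤ S := fun z => by
    have := SchwartzMap.one_add_le_sup_seminorm_apply (𝕜 := ℝ) (m := (3, 1)) (k := 3) (n := 1)
      le_rfl le_rfl φ z
    rwa [norm_iteratedFDeriv_one] at this
  refine ⟨(2 * R + 2) ^ 3 * S, by positivity, fun p τ hp1 hp2 => ?_⟩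
  set z := p.1 + τ • p.2 with hz
  -- Since `‖p.2‖ ≥ 1/2`, the triangle inequality gives `|τ| / 2 ≤ ‖z‖ + R`.
  have hτ : 1 + |τ| ≤ (2 * R + 2) * (1 + ‖z‖) := by
    have h2 : ‖τ • p.2‖ ≤ ‖z‖ + ‖p.1‖ := by
      have : τ • p.2 = z - p.1 := by rw [hz]; abel
      rw [this]
      exact norm_sub_le _ _
    rw [norm_smul, Real.norm_eq_abs] at h2
    nlinarith [abs_nonneg τ, norm_nonneg z]
  have key : ∀ b : ℝ, 0 ≤ b → (1 + ‖z‖) ^ 3 * b ≤ S →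
      b ≤ (2 * R + 2) ^ 3 * S * (1 + |τ|) ^ (-3 : ℤ) := by
    intro b hb h
    have hpos : 0 < (1 + |τ|) ^ 3 := by positivity
    rw [zpow_neg, ← div_eq_mul_inv, show (1 + |τ|) ^ (3 : ℤ) = (1 + |τ|) ^ 3 by norm_cast,
      le_div_iff₀ hpos]
    calc b * (1 + |τ|) ^ 3 ≤ b * ((2 * R + 2) * (1 + ‖z‖)) ^ 3 := by gcongr
      _ = (2 * R + 2) ^ 3 * ((1 + ‖z‖) ^ 3 * b) := by ring
      _ ≤ _ := by gcongr
  exact ⟨key _ (norm_nonneg _) (h0 z), key _ (norm_nonneg _) (h1 z)⟩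

lemma integrable_one_add_abs_neg_two : Integrable fun τ : ℝ => (1 + |τ|) ^ (-2 : ℤ) := by
  have h := integrable_one_add_norm (E := ℝ) (μ := volume) (r := 2) (by simp)
  refine h.congr (Eventually.of_forall fun τ => ?_)
  simp only [Real.norm_eq_abs]
  rw [← Real.rpow_intCast]
  norm_num

/-- Differentiation under the integral over a ball of radius `1/2`, where `‖p.2‖ ≥ 1/2`.
Differentiating in the direction costs a factor `1 + |τ|`, so cubic decay of the field and its
derivative leaves the integrable bound `(1 + |τ|)⁻²`. -/
lemma hasFDerivAt_integral_rayIntegrand (f : Fin n → 𝓢(E n, ℂ)) {p₀ : E n × E n}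
    (hp : ‖p₀.2‖ = 1) :
    Integrable (rayDeriv f p₀) ∧
    HasFDerivAt (fun p => ∫ τ, rayIntegrand f p τ) (∫ τ, rayDeriv f p₀ τ) p₀ := by
  set R := ‖p₀.1‖ + 1 / 2 with hR
  choose C hC0 hC using fun j => exists_decay (f j) R (by positivity)
  have hball : ∀ p ∈ Metric.ball p₀ (1 / 2), ‖p.1‖ ≤ R ∧ 1 / 2 ≤ ‖p.2‖ ∧ ‖p.2‖ ≤ 2 := by
    intro p hp'
    rw [mem_ball_iff_norm] at hp'
    have h1 := (norm_fst_le (p - p₀)).trans hp'.le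
    have h2 := (norm_snd_le (p - p₀)).trans hp'.le
    rw [Prod.fst_sub] at h1
    rw [Prod.snd_sub] at h2
    have h3 := norm_sub_norm_le p.1 p₀.1
    have h4 := norm_sub_norm_le p.2 p₀.2
    have h5 := norm_sub_norm_le p₀.2 p.2
    rw [norm_sub_rev] at h5
    refine ⟨?_, ?_, ?_⟩ <;> linarith
  have hz : ∀ τ : ℝ, (1 + |τ|) ^ (-3 : ℤ) * (1 + |τ|) = (1 + |τ|) ^ (-2 : ℤ) := fun τ => by
    rw [← zpow_add_one₀ (by positivity)]; norm_num
  have hz' : ∀ τ : ℝ, (1 + |τ|) ^ (-3 : ℤ) ≤ (1 + |τ|) ^ (-2 : ℤ) := fun τ =>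
    zpow_le_zpow_right₀ (by linarith [abs_nonneg τ]) (by norm_num)
  have hbound : ∀ p ∈ Metric.ball p₀ (1 / 2), ∀ τ,
      ‖rayDeriv f p τ‖ ≤ (∑ j, 3 * C j) * (1 + |τ|) ^ (-2 : ℤ) := by
    intro p hp' τ
    obtain ⟨h1, h2, h3⟩ := hball p hp'
    rw [Finset.sum_mul]
    refine (norm_sum_le _ _).trans (Finset.sum_le_sum fun j _ => ?_)
    obtain ⟨h4, h5⟩ := hC j p τ h1 h2
    have h6 : ‖((p.2 j : ℝ) : ℂ)‖ ≤ 2 := by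
      rw [Complex.norm_real]
      exact (PiLp.norm_apply_le p.2 j).trans h3
    calc _ ≤ ‖f j (p.1 + τ • p.2)‖ * ‖(dirCoord j : E n × E n →L[ℝ] ℂ)‖ +
          ‖((p.2 j : ℝ) : ℂ)‖ * (‖fderiv ℝ (f j) (p.1 + τ • p.2)‖ * ‖linePoint n τ‖) := by
          refine (norm_add_le _ _).trans (add_le_add
            (ContinuousLinearMap.opNorm_smul_le _ _)
            ((ContinuousLinearMap.opNorm_smul_le _ _).trans ?_))
          gcongr
          exact ContinuousLinearMap.opNorm_comp_le _ _
      _ ≤ C j * (1 + |τ|) ^ (-3 : ℤ) * 1 + 2 * (C j * (1 + |τ|) ^ (-3 : ℤ) * (1 + |τ|)) := by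
          have := hC0 j
          gcongr
          · exact norm_dirCoord_le j
          · exact norm_linePoint_le τ
      _ = C j * (1 + |τ|) ^ (-3 : ℤ) + 2 * (C j * (1 + |τ|) ^ (-2 : ℤ)) := by
          rw [mul_one, mul_assoc (C j), hz]
      _ ≤ C j * (1 + |τ|) ^ (-2 : ℤ) + 2 * (C j * (1 + |τ|) ^ (-2 : ℤ)) := by
          have := mul_le_mul_of_nonneg_left (hz' τ) (hC0 j)
          linarith
      _ = _ := by ring
  have hcont : ∀ p, Continuous (rayIntegrand f p) := by
    intro p
    unfold rayIntegrand
    refine continuous_finsetSum _ fun j _ => ((f j).continuous.comp (by fun_prop)).mul (by fun_prop)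
  have hcont' : Continuous (rayDeriv f p₀) := by
    unfold rayDeriv linePoint
    have : ∀ j, Continuous (fderiv ℝ (f j)) := fun j => ((f j).smooth 1).continuous_fderiv one_ne_zero
    refine continuous_finsetSum _ fun j _ => ?_
    refine (((f j).continuous.comp (by fun_prop)).smul continuous_const).add
      (Continuous.fun_const_smul ?_ _)
    exact ((this j).comp (by fun_prop : Continuous fun τ : ℝ => p₀.1 + τ • p₀.2)).clm_comp
      (continuous_const.add (continuous_id.smul continuous_const))
  have hmem := Metric.ball_mem_nhds p₀ (half_pos one_pos)
  have hbi : Integrable fun τ : ℝ => (∑ j, 3 * C j) * (1 + |τ|) ^ (-2 : ℤ) :=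
    integrable_one_add_abs_neg_two.const_mul _
  refine ⟨hbi.mono' hcont'.aestronglyMeasurable (Eventually.of_forall fun τ =>
    hbound p₀ (Metric.mem_ball_self (half_pos one_pos)) τ),
    hasFDerivAt_integral_of_dominated_of_fderiv_le hmem
      (Eventually.of_forall fun p => (hcont p).aestronglyMeasurable) ?_
      hcont'.aestronglyMeasurable (Eventually.of_forall fun τ p hp' => hbound p hp' τ) hbi
      (Eventually.of_forall fun τ p _ => hasFDerivAt_rayIntegrand f p τ)⟩
  refine hbi.mono' (hcont p₀).aestronglyMeasurable (Eventually.of_forall fun τ => ?_)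
  rw [Finset.sum_mul]
  refine (norm_sum_le _ _).trans (Finset.sum_le_sum fun j _ => ?_)
  obtain ⟨h1, h2, -⟩ := hball p₀ (Metric.mem_ball_self (half_pos one_pos))
  rw [norm_mul, Complex.norm_real]
  have h3 := mul_le_mul (hC j p₀ τ h1 h2).1 ((PiLp.norm_apply_le p₀.2 j).trans hp.le)
    (norm_nonneg _) (mul_nonneg (hC0 j) (by positivity))
  have h4 := mul_le_mul_of_nonneg_left (hz' τ) (hC0 j)
  have h5 : 0 ≤ C j * (1 + |τ|) ^ (-2 : ℤ) := mul_nonneg (hC0 j) (by positivity)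
  linarith

lemma inner_single_one (i : Fin n) (v : E n) :
    ⟪(EuclideanSpace.single i 1 : E n), v⟫_ℝ = v i := by
  rw [EuclideanSpace.inner_single_left, map_one, one_mul]

lemma inner_single_one' (i : Fin n) (v : E n) :
    ⟪v, (EuclideanSpace.single i 1 : E n)⟫_ℝ = v i := by
  rw [real_inner_comm, inner_single_one]

open LineDeriv in
/-- The Schwartz function whose ray transform is `Ξᵢ` of the ray transform of order zero. -/
def xiComp (i : Fin n) (f : Fin n → 𝓢(E n, ℂ)) (ξ : E n) : 𝓢(E n, ℂ) :=
  f i - ∂_{ξ} (mulInner (EuclideanSpace.single i 1) (dirComp f ξ)) +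
    ∂_{(EuclideanSpace.single i 1 : E n)} (mulInner ξ (dirComp f ξ)) -
    ((ξ i : ℝ) : ℂ) • dirComp f ξ

/-- Along `xiField i` the point `z = x + τξ` moves with velocity `-zᵢ ξ + τ eᵢ`, and `τ = ⟨ξ, z⟩`.
The derivative therefore depends on `x` and `τ` only through `z`; the product rule puts it into the
form of `xiComp`. -/
lemma rayDeriv_xiField (i : Fin n) (f : Fin n → 𝓢(E n, ℂ)) {x ξ : E n} (hξ : ‖ξ‖ = 1)
    (hx : ⟪ξ, x⟫_ℝ = 0) (τ : ℝ) :
    rayDeriv f (x, ξ) τ (xiField i (x, ξ)) = xiComp i f ξ (x + τ • ξ) := by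
  set z := x + τ • ξ with hz
  have hzξ : ⟪ξ, z⟫_ℝ = τ := by
    rw [hz, inner_add_right, hx, real_inner_smul_right, real_inner_self_eq_norm_sq, hξ]; ring
  have hzi : ⟪(EuclideanSpace.single i 1 : E n), z⟫_ℝ = x i + τ * ξ i := by
    rw [inner_single_one, hz]
    rfl
  have hq : ∀ v, fderiv ℝ (dirComp f ξ) z v = ∑ j, ((ξ j : ℝ) : ℂ) * fderiv ℝ (f j) z v := by
    intro v
    have h1 : HasFDerivAt (fun z => ∑ j, ((ξ j : ℝ) : ℂ) * f j z)
        (∑ j, ((ξ j : ℝ) : ℂ) • fderiv ℝ (f j) z) z :=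
      HasFDerivAt.fun_sum fun j _ => ((f j).hasFDerivAt z).const_mul _
    have h2 : (⇑(dirComp f ξ) : E n → ℂ) = fun z => ∑ j, ((ξ j : ℝ) : ℂ) * f j z := by
      funext z
      simp [dirComp_apply, mul_comm]
    rw [h2, h1.fderiv]
    simp
  have hl : linePoint n τ (xiField i (x, ξ)) =
      -(x i + τ * ξ i) • ξ + τ • EuclideanSpace.single i 1 := by
    rw [linePoint_apply, xiField]
    module
  have hd : ∀ j, dirCoord j (xiField i (x, ξ)) = (if j = i then 1 else 0) - (ξ i : ℂ) * ξ j := by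
    intro j
    rw [dirCoord_apply, xiField]
    simp [apply_ite]
  have hsum : rayDeriv f (x, ξ) τ (xiField i (x, ξ)) =
      f i z - (ξ i : ℂ) * dirComp f ξ z +
        fderiv ℝ (dirComp f ξ) z (-(x i + τ * ξ i) • ξ + τ • EuclideanSpace.single i 1) := by
    rw [hq, dirComp_apply, Finset.mul_sum, rayDeriv, _root_.sum_apply,
      show f i z = ∑ j, f j z * (if j = i then 1 else 0) by simp, ← Finset.sum_sub_distrib,
      ← Finset.sum_add_distrib]
    refine Finset.sum_congr rfl fun j _ => ?_
    simp only [_root_.add_apply, _root_.smul_apply,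
      ContinuousLinearMap.comp_apply, hl, hd, smul_eq_mul]
    ring
  rw [hsum, xiComp]
  simp only [_root_.sub_apply, _root_.add_apply, _root_.smul_apply, lineDeriv_mulInner, hzξ, hzi,
    map_add, map_smul, smul_eq_mul, Complex.real_smul]
  rw [inner_single_one, inner_single_one']
  push_cast
  ring

lemma Xi_momentRay_zero (i : Fin n) (f : Fin n → 𝓢(E n, ℂ)) {x ξ : E n} (hξ : ‖ξ‖ = 1)
    (hx : ⟪ξ, x⟫_ℝ = 0) :
    Xi i (momentRay 0 f) (x, ξ) = ∫ τ : ℝ, xiComp i f ξ (x + τ • ξ) := by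
  obtain ⟨h1, h2⟩ := hasFDerivAt_integral_rayIntegrand f (p₀ := (x, ξ)) hξ
  have h3 : extendTS (momentRay 0 f) =ᶠ[𝓝 (x, ξ)] fun p => ∫ τ, rayIntegrand f p τ := by
    have : ∀ᶠ p : E n × E n in 𝓝 (x, ξ), p.2 ≠ 0 :=
      (continuous_snd.tendsto (x, ξ)).eventually_ne (by rintro rfl; simp at hξ)
    filter_upwards [this] with p hp
    exact extendTS_momentRay_zero f hp
  rw [Xi, h3.fderiv_eq, h2.fderiv, ContinuousLinearMap.integral_apply h1]
  exact integral_congr_ae (Eventually.of_forall fun τ => rayDeriv_xiField i f hξ hx τ)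

/-- The `∂_ξ` term of `xiComp` contributes `i⟨y, ξ⟩ = 0`, and the `∂ᵢ` term contributes `i yᵢ` times
the transform behind `I¹f`. -/
lemma fourierTS_Xi_momentRay_zero (i : Fin n) (f : Fin n → 𝓢(E n, ℂ)) {y ξ : E n} (hξ : ‖ξ‖ = 1)
    (hy : ⟪y, ξ⟫_ℝ = 0) : fourierTS (Xi i (momentRay 0 f)) (y, ξ) = (√(2 * Real.pi) : ℂ) *
      (fourierE (f i) y + Complex.I * (y i : ℝ) * fourierE (mulInner ξ (dirComp f ξ)) y -
        (ξ i : ℝ) * fourierE (dirComp f ξ) y) := by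
  rw [fourierTS_of_ray (xiComp i f ξ) hξ hy fun x => Xi_momentRay_zero i f hξ
    (Submodule.mem_orthogonal_singleton_iff_inner_right.1 x.2), xiComp, fourierE_sub, fourierE_add,
    fourierE_sub, fourierE_lineDeriv, fourierE_lineDeriv, fourierE_smul, hy, inner_single_one']
  simp

/-! ### The estimate for Schwartz fields -/

/-- The Fourier transform of `I⁰f`, as a function on `ℝⁿ × ℝⁿ`. -/
def rayFourier₀ (f : Fin n → 𝓢(E n, ℂ)) (p : E n × E n) : ℂ :=
  (√(2 * Real.pi) : ℂ) * fourierE (dirComp f p.2) p.1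

/-- The Fourier transform of `I¹f`, as a function on `ℝⁿ × ℝⁿ`. -/
def rayFourier₁ (f : Fin n → 𝓢(E n, ℂ)) (p : E n × E n) : ℂ :=
  (√(2 * Real.pi) : ℂ) * fourierE (mulInner p.2 (dirComp f p.2)) p.1

/-- The Fourier transform of `Ξᵢ(I⁰f)`, as a function on `ℝⁿ × ℝⁿ`. -/
def xiFourier (i : Fin n) (f : Fin n → 𝓢(E n, ℂ)) (p : E n × E n) : ℂ :=
  (√(2 * Real.pi) : ℂ) * (fourierE (f i) p.1 +
    Complex.I * (p.1 i : ℝ) * fourierE (mulInner p.2 (dirComp f p.2)) p.1 -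
      (p.2 i : ℝ) * fourierE (dirComp f p.2) p.1)

lemma fourierE_dirComp (f : Fin n → 𝓢(E n, ℂ)) (ξ y : E n) :
    fourierE (dirComp f ξ) y = ∑ j, ((ξ j : ℝ) : ℂ) * fourierE (f j) y := by
  simp_rw [dirComp, fourierE_sum, fourierE_smul]

/-- Expanding in coordinates separates `ξ` from `y`, which makes joint continuity in `(y, ξ)`
evident. -/
lemma fourierE_mulInner_dirComp (f : Fin n → 𝓢(E n, ℂ)) (ξ y : E n) :
    fourierE (mulInner ξ (dirComp f ξ)) y = ∑ k, ((ξ k : ℝ) : ℂ) * ∑ j, ((ξ j : ℝ) : ℂ) *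
      fourierE (mulInner (EuclideanSpace.single k 1) (f j)) y := by
  have : mulInner ξ (dirComp f ξ) = ∑ k, ((ξ k : ℝ) : ℂ) • ∑ j, ((ξ j : ℝ) : ℂ) •
      mulInner (EuclideanSpace.single k 1) (f j) := by
    ext z
    have hz : ⟪ξ, z⟫_ℝ = ∑ k, ξ k * z k := by
      simp [PiLp.inner_apply, mul_comm]
    simp only [mulInner_apply, dirComp_apply, _root_.sum_apply, _root_.smul_apply,
      smul_eq_mul, inner_single_one, hz, Complex.ofReal_sum, Complex.ofReal_mul, Finset.sum_mul,
      Finset.mul_sum]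
    rw [Finset.sum_comm]
    refine Finset.sum_congr rfl fun k _ => Finset.sum_congr rfl fun j _ => ?_
    ring
  simp_rw [this, fourierE_sum, fourierE_smul, fourierE_sum, fourierE_smul]

lemma continuous_fourierE_dirComp (f : Fin n → 𝓢(E n, ℂ)) :
    Continuous fun p : E n × E n => fourierE (dirComp f p.2) p.1 := by
  simp_rw [fourierE_dirComp]
  exact continuous_finsetSum _ fun j _ =>
    (by fun_prop : Continuous fun p : E n × E n => ((p.2 j : ℝ) : ℂ)).mul
      ((continuous_fourierE (f j)).comp continuous_fst)

lemma continuous_fourierE_mulInner_dirComp (f : Fin n → 𝓢(E n, ℂ)) :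
    Continuous fun p : E n × E n => fourierE (mulInner p.2 (dirComp f p.2)) p.1 := by
  simp_rw [fourierE_mulInner_dirComp]
  exact continuous_finsetSum _ fun k _ =>
    (by fun_prop : Continuous fun p : E n × E n => ((p.2 k : ℝ) : ℂ)).mul
      (continuous_finsetSum _ fun j _ =>
        (by fun_prop : Continuous fun p : E n × E n => ((p.2 j : ℝ) : ℂ)).mul
          ((continuous_fourierE _).comp continuous_fst))

lemma continuous_rayFourier₀ (f : Fin n → 𝓢(E n, ℂ)) : Continuous (rayFourier₀ f) :=
  continuous_const.mul (continuous_fourierE_dirComp f)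

lemma continuous_rayFourier₁ (f : Fin n → 𝓢(E n, ℂ)) : Continuous (rayFourier₁ f) :=
  continuous_const.mul (continuous_fourierE_mulInner_dirComp f)

lemma continuous_xiFourier (i : Fin n) (f : Fin n → 𝓢(E n, ℂ)) : Continuous (xiFourier i f) :=
  continuous_const.mul ((((continuous_fourierE (f i)).comp continuous_fst).add
    ((by fun_prop : Continuous fun p : E n × E n => Complex.I * ((p.1 i : ℝ) : ℂ)).mul
      (continuous_fourierE_mulInner_dirComp f))).sub
    ((by fun_prop : Continuous fun p : E n × E n => ((p.2 i : ℝ) : ℂ)).mul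
      (continuous_fourierE_dirComp f)))

/-- The inversion formula on which the estimate rests: the formula for the transform of `Ξᵢ(I⁰f)`
solved for `f̂ᵢ`. -/
lemma fourierE_eq_xiFourier (i : Fin n) (f : Fin n → 𝓢(E n, ℂ)) (p : E n × E n) :
    (√(2 * Real.pi) : ℂ) * fourierE (f i) p.1 = xiFourier i f p + (p.2 i : ℝ) * rayFourier₀ f p -
      Complex.I * (p.1 i : ℝ) * rayFourier₁ f p := by
  unfold xiFourier rayFourier₀ rayFourier₁
  ring

lemma sum_mul_coord_self {ξ : E n} (hξ : ‖ξ‖ = 1) :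
    ∑ i, ((ξ i : ℝ) : ℂ) * ((ξ i : ℝ) : ℂ) = 1 := by
  have h := real_inner_self_eq_norm_sq ξ
  rw [hξ, PiLp.inner_apply] at h
  simp only [RCLike.inner_apply, conj_trivial] at h
  exact_mod_cast h.trans (one_pow 2)

lemma sum_mul_coord_of_inner {y ξ : E n} (hy : ⟪y, ξ⟫_ℝ = 0) :
    ∑ i, ((ξ i : ℝ) : ℂ) * ((y i : ℝ) : ℂ) = 0 := by
  rw [PiLp.inner_apply] at hy
  simp only [RCLike.inner_apply, conj_trivial] at hy
  exact_mod_cast hy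

/-- Contracting with `ξ`, the first and third terms cancel because `|ξ| = 1`, and the middle one
vanishes because `y ⟂ ξ`. -/
lemma sum_xiFourier (f : Fin n → 𝓢(E n, ℂ)) {p : E n × E n} (h2 : ‖p.2‖ = 1)
    (h1 : ⟪p.1, p.2⟫_ℝ = 0) : ∑ i, ((p.2 i : ℝ) : ℂ) * xiFourier i f p = 0 := by
  set A := fourierE (dirComp f p.2) p.1 with hA
  set B := fourierE (mulInner p.2 (dirComp f p.2)) p.1 with hB
  have : ∀ i, ((p.2 i : ℝ) : ℂ) * xiFourier i f p = (√(2 * Real.pi) : ℂ) *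
      (((p.2 i : ℝ) : ℂ) * fourierE (f i) p.1 +
        Complex.I * B * (((p.2 i : ℝ) : ℂ) * ((p.1 i : ℝ) : ℂ)) -
        A * (((p.2 i : ℝ) : ℂ) * ((p.2 i : ℝ) : ℂ))) := fun i => by
    rw [xiFourier]
    ring
  rw [Finset.sum_congr rfl fun i _ => this i, ← Finset.mul_sum, Finset.sum_sub_distrib,
    Finset.sum_add_distrib, ← Finset.mul_sum, ← Finset.mul_sum, sum_mul_coord_self h2,
    sum_mul_coord_of_inner h1, ← fourierE_dirComp]
  ring

/-- The pointwise estimate behind the stability estimate. -/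
lemma sum_norm_sq_le {y ξ : E n} (hξ : ‖ξ‖ = 1) (hy : ⟪y, ξ⟫_ℝ = 0) (g : Fin n → ℂ) (g₀ g₁ : ℂ)
    (hg : ∑ i, ((ξ i : ℝ) : ℂ) * g i = 0) :
    ∑ i, ‖g i + (ξ i : ℝ) * g₀ - Complex.I * (y i : ℝ) * g₁‖ ^ 2 ≤
      2 * ((∑ i, ‖g i‖ ^ 2) + ‖g₀‖ ^ 2 + ‖y‖ ^ 2 * ‖g₁‖ ^ 2) := by
  -- The component orthogonal to `ξ`. The cross terms with `ξ g₀` sum to zero by `hb0`, so `g₀`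
  -- enters with coefficient one.
  set b : Fin n → ℂ := fun i => g i - Complex.I * (y i : ℝ) * g₁ with hb
  have hb0 : ∑ i, ((ξ i : ℝ) : ℂ) * b i = 0 := by
    have : ∀ i, ((ξ i : ℝ) : ℂ) * b i = ((ξ i : ℝ) : ℂ) * g i -
        Complex.I * g₁ * (((ξ i : ℝ) : ℂ) * ((y i : ℝ) : ℂ)) := fun i => by rw [hb]; ring
    rw [Finset.sum_congr rfl fun i _ => this i, Finset.sum_sub_distrib, ← Finset.mul_sum, hg,
      sum_mul_coord_of_inner hy]
    ring
  have h1 : ∀ i, ‖g i + (ξ i : ℝ) * g₀ - Complex.I * (y i : ℝ) * g₁‖ ^ 2 =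
      ‖b i‖ ^ 2 + (ξ i) ^ 2 * ‖g₀‖ ^ 2 +
        2 * ((((ξ i : ℝ) : ℂ) * b i) * (starRingEnd ℂ) g₀).re := fun i => by
    rw [show g i + (ξ i : ℝ) * g₀ - Complex.I * (y i : ℝ) * g₁ = b i + (ξ i : ℝ) * g₀ by
      rw [hb]; ring]
    simp only [Complex.sq_norm, Complex.normSq_apply, Complex.add_re, Complex.add_im,
      Complex.mul_re, Complex.mul_im, Complex.ofReal_re, Complex.ofReal_im, Complex.conj_re,
      Complex.conj_im]
    ring
  have h2 : ∀ i, ‖b i‖ ^ 2 ≤ 2 * ‖g i‖ ^ 2 + 2 * ((y i) ^ 2 * ‖g₁‖ ^ 2) := fun i => by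
    have h3 : ‖b i‖ ≤ ‖g i‖ + |y i| * ‖g₁‖ := by
      refine (norm_sub_le _ _).trans_eq ?_
      simp
    have h4 := pow_le_pow_left₀ (norm_nonneg _) h3 2
    have h5 : (|y i| * ‖g₁‖) ^ 2 = (y i) ^ 2 * ‖g₁‖ ^ 2 := by rw [mul_pow, sq_abs]
    nlinarith [sq_nonneg (‖g i‖ - |y i| * ‖g₁‖)]
  have hyn : ∑ i, (y i) ^ 2 = ‖y‖ ^ 2 := by rw [EuclideanSpace.norm_sq_eq]; simp
  have hξn : ∑ i, (ξ i) ^ 2 = 1 := by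
    rw [← one_pow 2, ← hξ, EuclideanSpace.norm_sq_eq]; simp
  rw [Finset.sum_congr rfl fun i _ => h1 i, Finset.sum_add_distrib, Finset.sum_add_distrib,
    ← Finset.sum_mul, hξn, ← Finset.mul_sum, ← Complex.re_sum, ← Finset.sum_mul, hb0, zero_mul,
    Complex.zero_re]
  have h6 := Finset.sum_le_sum fun i (_ : i ∈ Finset.univ) => h2 i
  rw [Finset.sum_add_distrib, ← Finset.mul_sum, ← Finset.mul_sum, ← Finset.sum_mul, hyn] at h6
  nlinarith [sq_nonneg ‖g₀‖]

lemma weight_add_half (s t : ℝ) {y : E n} (hy : y ≠ 0) :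
    weight (s + 1 / 2) (t + 1 / 2) y = ‖y‖ * weight s t y := by
  rw [weight, weight, show 2 * (t + 1 / 2) = 2 * t + 1 by ring,
    Real.rpow_add_one (norm_ne_zero_iff.2 hy),
    show s + 1 / 2 - (t + 1 / 2) = s - t by ring]
  ring

lemma weight_add_three_half (s t : ℝ) {y : E n} (hy : y ≠ 0) :
    weight (s + 3 / 2) (t + 3 / 2) y = ‖y‖ ^ 2 * weight (s + 1 / 2) (t + 1 / 2) y := by
  rw [show s + 3 / 2 = s + 1 / 2 + 1 / 2 + 1 / 2 by ring,
    show t + 3 / 2 = t + 1 / 2 + 1 / 2 + 1 / 2 by ring, weight_add_half _ _ hy,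
    weight_add_half _ _ hy]
  ring

lemma measurable_weight_mul_sq (s t : ℝ) {g : E n × E n → ℂ} (hg : Measurable g) :
    Measurable fun p : E n × E n => ENNReal.ofReal (weight s t p.1 * ‖g p‖ ^ 2) :=
  (((weight_measurable s t).comp measurable_fst).mul (hg.norm.pow_const 2)).ennreal_ofReal

lemma normSqTS_eq (s t : ℝ) {g : E n × E n → ℂ} (hg : Measurable g) : normSqTS s t g =
    ENNReal.ofReal (2 * Real.pi)⁻¹ *
      ∫⁻ p, ENNReal.ofReal (weight s t p.1 * ‖g p‖ ^ 2) ∂measureTS n := by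
  rw [normSqTS, lintegral_measureTS (measurable_weight_mul_sq s t hg)]

lemma inner_eq_zero_of_perp {ξ : E n} (y : (ℝ ∙ ξ)ᗮ) : ⟪(y : E n), ξ⟫_ℝ = 0 :=
  Submodule.mem_orthogonal_singleton_iff_inner_left.1 y.2

lemma normSqTS_congr (s t : ℝ) {g g' : E n × E n → ℂ}
    (h : ∀ y ξ : E n, ‖ξ‖ = 1 → ⟪y, ξ⟫_ℝ = 0 → g (y, ξ) = g' (y, ξ)) :
    normSqTS s t g = normSqTS s t g' := by
  unfold normSqTS
  congr 1
  refine lintegral_congr fun ξ => lintegral_congr fun y => ?_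
  rw [h y ξ (norm_sphere ξ) (inner_eq_zero_of_perp y)]

/-- Integration of the pointwise estimate. -/
lemma sum_lintegral_le (hn : 2 ≤ n) (s t : ℝ) {F : Fin n → E n × E n → ℂ}
    {g : Fin n → E n × E n → ℂ} {g₀ g₁ : E n × E n → ℂ} (hF : ∀ i, Measurable (F i))
    (hg : ∀ i, Measurable (g i)) (hg₀ : Measurable g₀) (hg₁ : Measurable g₁)
    (h1 : ∀ᵐ p ∂measureTS n, ∀ i, (√(2 * Real.pi) : ℂ) * F i p =
      g i p + (p.2 i : ℝ) * g₀ p - Complex.I * (p.1 i : ℝ) * g₁ p)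
    (h2 : ∀ᵐ p ∂measureTS n, ∑ i, ((p.2 i : ℝ) : ℂ) * g i p = 0) :
    ∑ i, ∫⁻ p, ENNReal.ofReal (weight (s + 1 / 2) (t + 1 / 2) p.1 * ‖F i p‖ ^ 2) ∂measureTS n ≤
      2 * ((∑ i, normSqTS (s + 1 / 2) (t + 1 / 2) (g i)) +
        normSqTS (s + 1 / 2) (t + 1 / 2) g₀ + normSqTS (s + 3 / 2) (t + 3 / 2) g₁) := by
  have hw := fun (p : E n × E n) => weight_nonneg (s + 1 / 2) (t + 1 / 2) p.1
  rw [normSqTS_eq _ _ hg₀, normSqTS_eq _ _ hg₁, Finset.sum_congr rfl fun i _ =>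
    normSqTS_eq _ _ (hg i), ← Finset.mul_sum, ← mul_add, ← mul_add,
    ← lintegral_finsetSum _ fun i _ => measurable_weight_mul_sq _ _ (hF i),
    ← lintegral_finsetSum _ fun i _ => measurable_weight_mul_sq _ _ (hg i),
    ← lintegral_add_left (Finset.measurable_fun_sum _ fun i _ =>
      measurable_weight_mul_sq _ _ (hg i)),
    ← lintegral_add_right _ (measurable_weight_mul_sq _ _ hg₁), ← mul_assoc,
    ← lintegral_const_mul' _ _ (by finiteness)]
  refine lintegral_mono_ae ?_
  filter_upwards [h1, h2, ae_measureTS, ae_measureTS_ne_zero hn] with p hp1 hp2 hp3 hp4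
  have h3 := sum_norm_sq_le hp3.1 hp3.2 (fun i => g i p) (g₀ p) (g₁ p) hp2
  simp_rw [← hp1, norm_mul, mul_pow] at h3
  rw [← Finset.mul_sum, Complex.norm_real, Real.norm_eq_abs, sq_abs,
    Real.sq_sqrt (by positivity)] at h3
  have hpi : (0 : ℝ) < 2 * Real.pi := by positivity
  have h5 : 2 * ENNReal.ofReal (2 * Real.pi)⁻¹ = ENNReal.ofReal (2 * (2 * Real.pi)⁻¹) := by
    rw [ENNReal.ofReal_mul two_pos.le, ENNReal.ofReal_ofNat]
  rw [weight_add_three_half _ _ hp4, ← ENNReal.ofReal_sum_of_nonneg fun i _ => by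
      have := hw p; positivity, ← ENNReal.ofReal_sum_of_nonneg fun i _ => by
      have := hw p; positivity, ← ENNReal.ofReal_add (Finset.sum_nonneg fun i _ => by
      have := hw p; positivity) (by have := hw p; positivity),
    ← ENNReal.ofReal_add (add_nonneg (Finset.sum_nonneg fun i _ => by
      have := hw p; positivity) (by have := hw p; positivity)) (by have := hw p; positivity),
    h5, ← ENNReal.ofReal_mul (by positivity)]
  refine ENNReal.ofReal_le_ofReal ?_
  rw [← Finset.mul_sum, ← Finset.mul_sum]
  have h4 := mul_le_mul_of_nonneg_left h3 (mul_nonneg (hw p) (inv_nonneg.2 hpi.le))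
  calc _ = weight (s + 1 / 2) (t + 1 / 2) p.1 * (2 * Real.pi)⁻¹ *
        (2 * Real.pi * ∑ i, ‖F i p‖ ^ 2) := by
        field_simp
    _ ≤ _ := h4
    _ = _ := by ring

/-- The `H^s_t` norm of a Schwartz field as an integral over `TSⁿ⁻¹`. -/
lemma ofReal_sobolevSq (hn : 2 ≤ n) (s t : ℝ) (ht : -(n : ℝ) / 2 < t) (f : Fin n → 𝓢(E n, ℂ)) :
    ENNReal.ofReal (sobolevSq s t f) = ENNReal.ofReal (a n) * ∑ i, ∫⁻ p,
      ENNReal.ofReal (weight (s + 1 / 2) (t + 1 / 2) p.1 * ‖fourierE (f i) p.1‖ ^ 2)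
        ∂measureTS n := by
  have hw := fun y : E n => weight_nonneg s t y
  have hi : ∀ i, Integrable fun y : E n => weight s t y * ‖fourierE (f i) y‖ ^ 2 := fun i => by
    obtain ⟨ψ, hψ⟩ := fourierE_schwartz (f i)
    simpa only [hψ] using weight_integrable s t ht ψ
  have h0 : ∀ i (y : E n), 0 ≤ weight s t y * ‖fourierE (f i) y‖ ^ 2 := fun i y =>
    mul_nonneg (hw y) (by positivity)
  rw [sobolevSq, ENNReal.ofReal_sum_of_nonneg fun i _ => integral_nonneg (h0 i), Finset.mul_sum]
  refine Finset.sum_congr rfl fun i _ => ?_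
  have hm : Measurable fun y : E n => weight s t y * ‖fourierE (f i) y‖ ^ 2 :=
    (weight_measurable s t).mul ((continuous_fourierE (f i)).measurable.norm.pow_const 2)
  have hm' : Measurable fun y : E n =>
      ‖y‖ₑ * ENNReal.ofReal (weight s t y * ‖fourierE (f i) y‖ ^ 2) :=
    measurable_enorm.mul hm.ennreal_ofReal
  rw [ofReal_integral_eq_lintegral_ofReal (hi i) (Eventually.of_forall (h0 i)),
    lintegral_eq_hyperplaneMeasure hn hm, hyperplaneMeasure,
    lintegral_map hm' measurable_fst]
  · congr 1
    refine lintegral_congr_ae ?_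
    filter_upwards [ae_measureTS_ne_zero hn] with p hp
    rw [← ofReal_norm, ← ENNReal.ofReal_mul (norm_nonneg _), weight_add_half _ _ hp, mul_assoc]
  -- Away from the origin only: for `t < 0` the weight is singular at `0`.
  · intro x hx
    have h1 := norm_ne_zero_iff.2 hx
    refine ContinuousAt.mul ?_ ((continuous_fourierE (f i)).norm.pow 2).continuousAt
    unfold weight
    refine ContinuousAt.mul (continuous_norm.continuousAt.rpow_const (Or.inl h1))
      (ContinuousAt.rpow_const (by fun_prop) (Or.inl (by positivity)))

theorem sobolevSq_le (hn : 2 ≤ n) (s t : ℝ) (ht : -(n : ℝ) / 2 < t) (f : Fin n → 𝓢(E n, ℂ)) :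
    ENNReal.ofReal (sobolevSq s t f) ≤ ENNReal.ofReal (2 * a n) *
      ((∑ i, normSqTS (s + 1 / 2) (t + 1 / 2) (fourierTS (Xi i (momentRay 0 f))))
        + normSqTS (s + 1 / 2) (t + 1 / 2) (fourierTS (momentRay 0 f))
        + normSqTS (s + 3 / 2) (t + 3 / 2) (fourierTS (momentRay 1 f))) := by
  rw [normSqTS_congr (g' := rayFourier₀ f) _ _ fun y ξ hξ hy => fourierTS_momentRay_zero f hξ hy,
    normSqTS_congr (g' := rayFourier₁ f) _ _ fun y ξ hξ hy => fourierTS_momentRay_one f hξ hy,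
    Finset.sum_congr rfl fun i _ => normSqTS_congr (g' := xiFourier i f) _ _ fun y ξ hξ hy =>
      fourierTS_Xi_momentRay_zero i f hξ hy, ofReal_sobolevSq hn s t ht, mul_comm 2,
    ENNReal.ofReal_mul (a_pos hn).le, mul_assoc, ENNReal.ofReal_ofNat]
  refine mul_le_mul_right (sum_lintegral_le hn s t
    (fun i => ((continuous_fourierE (f i)).comp continuous_fst).measurable)
    (fun i => (continuous_xiFourier i f).measurable) (continuous_rayFourier₀ f).measurable
    (continuous_rayFourier₁ f).measurable
    (Eventually.of_forall fun p i => fourierE_eq_xiFourier i f p) ?_) _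
  filter_upwards [ae_measureTS] with p hp
  exact sum_xiFourier f hp.1 hp.2

/-! ### Pairings with test functions -/

/-- The complement of the zero section. -/
def awayZero (n : ℕ) : Set (E n × E n) := {p | p.1 ≠ 0}

lemma isOpen_awayZero : IsOpen (awayZero n) := isOpen_ne_fun continuous_fst continuous_const

lemma IsTest.tsupport_subset {χ : E n × E n → ℝ} (hχ : IsTest χ) : tsupport χ ⊆ awayZero n :=
  hχ.away

/-- Allows the coefficients `ξᵢ` and `yᵢ` of the inversion formula to be absorbed into the test
function. -/
lemma IsTest.mul {χ : E n × E n → ℝ} (hχ : IsTest χ) {c : E n × E n → ℝ} (hc : ContDiff ℝ ∞ c) :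
    IsTest fun p => χ p * c p where
  smooth := hχ.smooth.mul hc
  compact := hχ.compact.mul_right
  away p hp := hχ.away p (tsupport_mul_subset_left hp)

lemma contDiff_coord_fst (i : Fin n) : ContDiff ℝ ∞ fun p : E n × E n => p.1 i :=
  ((EuclideanSpace.proj i : E n →L[ℝ] ℝ) ∘L ContinuousLinearMap.fst ℝ (E n) (E n)).contDiff

lemma contDiff_coord_snd (i : Fin n) : ContDiff ℝ ∞ fun p : E n × E n => p.2 i :=
  ((EuclideanSpace.proj i : E n →L[ℝ] ℝ) ∘L ContinuousLinearMap.snd ℝ (E n) (E n)).contDiff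

lemma IsTest.integrable_mul {χ : E n × E n → ℝ} (hχ : IsTest χ) {g : E n × E n → ℂ}
    (hg : LocallyIntegrableOn g (awayZero n) (measureTS n)) :
    Integrable (fun p => (χ p : ℂ) * g p) (measureTS n) := by
  have h1 := (hg.integrableOn_compact_subset hχ.tsupport_subset hχ.compact).continuousOn_mul
    (g := fun p => (χ p : ℂ)) (Complex.continuous_ofReal.comp hχ.smooth.continuous).continuousOn
    hχ.compact
  refine (integrableOn_iff_integrable_of_support_subset fun p hp => subset_tsupport _ ?_).1 h1
  rw [Function.mem_support] at hp ⊢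
  intro h
  simp [h] at hp

lemma pairTS_eq {χ : E n × E n → ℝ} (hχ : IsTest χ) {g : E n × E n → ℂ} (hm : Measurable g)
    (hg : LocallyIntegrableOn g (awayZero n) (measureTS n)) :
    pairTS g χ = ∫ p, (χ p : ℂ) * g p ∂measureTS n := by
  have h1 : Measurable fun p => (χ p : ℂ) * g p :=
    (Complex.measurable_ofReal.comp hχ.smooth.continuous.measurable).mul hm
  rw [pairTS, integral_measureTS h1 (hχ.integrable_mul hg)]

lemma pairTS_congr {g g' : E n × E n → ℂ} (χ : E n × E n → ℝ)
    (h : ∀ y ξ : E n, ‖ξ‖ = 1 → ⟪y, ξ⟫_ℝ = 0 → g (y, ξ) = g' (y, ξ)) :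
    pairTS g χ = pairTS g' χ := by
  unfold pairTS
  refine integral_congr_ae (Eventually.of_forall fun ξ => ?_)
  refine integral_congr_ae (Eventually.of_forall fun y => ?_)
  simp only
  rw [h y ξ (norm_sphere ξ) (inner_eq_zero_of_perp y)]

lemma Continuous.locallyIntegrableOn_awayZero {g : E n × E n → ℂ} (hg : Continuous g) :
    LocallyIntegrableOn g (awayZero n) (measureTS n) :=
  hg.locallyIntegrable.locallyIntegrableOn _

/-- Functions of finite weighted norm are locally integrable away from the zero section. -/
lemma locallyIntegrableOn_of_weight (s t : ℝ) {g : E n × E n → ℂ} (hg : Measurable g)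
    (hfin : ∫⁻ p, ENNReal.ofReal (weight s t p.1 * ‖g p‖ ^ 2) ∂measureTS n ≠ ⊤) :
    LocallyIntegrableOn g (awayZero n) (measureTS n) := by
  rw [locallyIntegrableOn_iff isOpen_awayZero.isLocallyClosed]
  intro K hK hKc
  have hwc : ContinuousOn (fun p : E n × E n => (weight s t p.1)⁻¹) K := by
    intro p hp
    have h1 := norm_pos_iff.2 (hK hp)
    refine (ContinuousAt.inv₀ ?_ ?_).continuousWithinAt
    · unfold weight
      exact ((by fun_prop : ContinuousAt (fun p : E n × E n => ‖p.1‖) p).rpow_const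
        (Or.inl h1.ne')).mul (ContinuousAt.rpow_const (by fun_prop) (Or.inl (by positivity)))
    · unfold weight
      positivity
  have hnn : ∀ p : E n × E n, 0 ≤ weight s t p.1 * ‖g p‖ ^ 2 := fun p =>
    mul_nonneg (weight_nonneg s t p.1) (by positivity)
  have hi : Integrable (fun p : E n × E n => weight s t p.1 * ‖g p‖ ^ 2) (measureTS n) := by
    refine ⟨(((weight_measurable s t).comp measurable_fst).mul
      (hg.norm.pow_const 2)).aestronglyMeasurable, ?_⟩
    rw [hasFiniteIntegral_iff_ofReal (Eventually.of_forall hnn)]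
    exact hfin.lt_top
  have h4 : IntegrableOn (fun p : E n × E n => (weight s t p.1)⁻¹ *
      (weight s t p.1 * ‖g p‖ ^ 2)) K (measureTS n) := hi.integrableOn.continuousOn_mul hwc hKc
  have h5 : IntegrableOn (fun _ : E n × E n => (1 : ℝ)) K (measureTS n) :=
    integrableOn_const hKc.measure_lt_top.ne
  have h2 : IntegrableOn (fun p : E n × E n => 1 + (weight s t p.1)⁻¹ *
      (weight s t p.1 * ‖g p‖ ^ 2)) K (measureTS n) := Integrable.add h5 h4
  refine Integrable.mono' h2 hg.aestronglyMeasurable ?_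
  refine (ae_restrict_iff' hKc.measurableSet).2 (Eventually.of_forall fun p hp => ?_)
  have h1 := norm_pos_iff.2 (hK hp)
  have h3 : weight s t p.1 ≠ 0 := by unfold weight; positivity
  rw [← mul_assoc, inv_mul_cancel₀ h3, one_mul]
  -- The bound `‖g‖ ≤ 1 + ‖g‖²` turns weighted square integrability into local integrability.
  nlinarith [sq_nonneg (‖g p‖ - 1), norm_nonneg (g p)]

/-- Test functions separate locally integrable functions on the open set `awayZero n`, whose
complement is null. -/
lemma ae_eq_zero_of_pairing (hn : 2 ≤ n) {h : E n × E n → ℂ}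
    (hh : LocallyIntegrableOn h (awayZero n) (measureTS n))
    (h0 : ∀ χ : E n × E n → ℝ, IsTest χ → ∫ p, (χ p : ℂ) * h p ∂measureTS n = 0) :
    ∀ᵐ p ∂measureTS n, h p = 0 := by
  have := isOpen_awayZero.ae_eq_zero_of_integral_contDiff_smul_eq_zero hh
    fun χ h1 h2 h3 => by simpa using h0 χ ⟨h1, h2, h3⟩
  filter_upwards [this, ae_measureTS_ne_zero hn] with p hp hp'
  exact hp hp'

lemma integral_test_mul_sub (i : Fin n) (c : ℂ) {χ : E n × E n → ℝ} (hχ : IsTest χ)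
    {F g g₀ g₁ : E n × E n → ℂ} (hF : LocallyIntegrableOn F (awayZero n) (measureTS n))
    (hg : LocallyIntegrableOn g (awayZero n) (measureTS n))
    (hg₀ : LocallyIntegrableOn g₀ (awayZero n) (measureTS n))
    (hg₁ : LocallyIntegrableOn g₁ (awayZero n) (measureTS n)) :
    ∫ p, (χ p : ℂ) * (c * F p - (g p + (p.2 i : ℝ) * g₀ p - Complex.I * (p.1 i : ℝ) * g₁ p))
        ∂measureTS n =
      c * ∫ p, (χ p : ℂ) * F p ∂measureTS n - (∫ p, (χ p : ℂ) * g p ∂measureTS n +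
        ∫ p, ((χ p * p.2 i : ℝ) : ℂ) * g₀ p ∂measureTS n -
        Complex.I * ∫ p, ((χ p * p.1 i : ℝ) : ℂ) * g₁ p ∂measureTS n) := by
  have h0 := hχ.integrable_mul hF
  have h1 := hχ.integrable_mul hg
  have h2 := (hχ.mul (contDiff_coord_snd i)).integrable_mul hg₀
  have h3 := ((hχ.mul (contDiff_coord_fst i)).integrable_mul hg₁).const_mul Complex.I
  have h4 : Integrable (fun p => (χ p : ℂ) * g p + ((χ p * p.2 i : ℝ) : ℂ) * g₀ p)
    (measureTS n) := h1.add h2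
  have h5 : Integrable (fun p => (χ p : ℂ) * g p + ((χ p * p.2 i : ℝ) : ℂ) * g₀ p -
    Complex.I * (((χ p * p.1 i : ℝ) : ℂ) * g₁ p)) (measureTS n) := h4.sub h3
  rw [← integral_const_mul, ← integral_const_mul, ← integral_add h1 h2, ← integral_sub h4 h3,
    ← integral_sub (h0.const_mul c) h5]
  refine integral_congr_ae (Eventually.of_forall fun p => ?_)
  simp only
  push_cast
  ring

/-! ### Embedding of `H^s_t` into a Lebesgue space over `TSⁿ⁻¹` -/

/-- The square root of the density which makes the Fourier transform an isometry. -/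
def rootWeight (s t : ℝ) (p : E n × E n) : ℝ := √(a n * weight (s + 1 / 2) (t + 1 / 2) p.1)

lemma measurable_rootWeight (s t : ℝ) : Measurable (rootWeight (n := n) s t) :=
  (((weight_measurable _ _).comp measurable_fst).const_mul _).sqrt

lemma rootWeight_sq (hn : 2 ≤ n) (s t : ℝ) (p : E n × E n) :
    rootWeight s t p ^ 2 = a n * weight (s + 1 / 2) (t + 1 / 2) p.1 :=
  Real.sq_sqrt (mul_nonneg (a_pos hn).le (weight_nonneg _ _ _))

lemma rootWeight_pos (hn : 2 ≤ n) (s t : ℝ) {p : E n × E n} (hp : p.1 ≠ 0) :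
    0 < rootWeight s t p := by
  have h1 := norm_pos_iff.2 hp
  have h2 := a_pos hn
  unfold rootWeight weight
  positivity

lemma continuousAt_rootWeight (s t : ℝ) {p : E n × E n} (hp : p.1 ≠ 0) :
    ContinuousAt (rootWeight s t) p := by
  have h1 := norm_pos_iff.2 hp
  unfold rootWeight weight
  refine ContinuousAt.sqrt (continuousAt_const.mul ?_)
  exact ((by fun_prop : ContinuousAt (fun p : E n × E n => ‖p.1‖) p).rpow_const
    (Or.inl h1.ne')).mul (ContinuousAt.rpow_const (by fun_prop) (Or.inl (by positivity)))

/-- The weighted Fourier transform as a function on `TSⁿ⁻¹`. -/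
def weightedTS (s t : ℝ) (φ : 𝓢(E n, ℂ)) (p : E n × E n) : ℂ :=
  (rootWeight s t p : ℂ) * fourierE φ p.1

lemma measurable_weightedTS (s t : ℝ) (φ : 𝓢(E n, ℂ)) : Measurable (weightedTS s t φ) :=
  (Complex.measurable_ofReal.comp (measurable_rootWeight s t)).mul
    ((continuous_fourierE φ).measurable.comp measurable_fst)

lemma enorm_rootWeight_mul_sq (hn : 2 ≤ n) (s t : ℝ) (p : E n × E n) (z : ℂ) :
    ‖(rootWeight s t p : ℂ) * z‖ₑ ^ 2 = ENNReal.ofReal (a n) *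
      ENNReal.ofReal (weight (s + 1 / 2) (t + 1 / 2) p.1 * ‖z‖ ^ 2) := by
  rw [← ofReal_norm, ← ENNReal.ofReal_pow (norm_nonneg _), norm_mul, mul_pow, Complex.norm_real,
    Real.norm_eq_abs, sq_abs, rootWeight_sq hn, mul_assoc, ENNReal.ofReal_mul (a_pos hn).le]

lemma sum_lintegral_weightedTS (hn : 2 ≤ n) (s t : ℝ) (ht : -(n : ℝ) / 2 < t)
    (f : Fin n → 𝓢(E n, ℂ)) : ∑ i, ∫⁻ p, ‖weightedTS s t (f i) p‖ₑ ^ 2 ∂measureTS n =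
      ENNReal.ofReal (sobolevSq s t f) := by
  rw [ofReal_sobolevSq hn s t ht, Finset.mul_sum]
  refine Finset.sum_congr rfl fun i _ => ?_
  rw [← lintegral_const_mul' _ _ (by finiteness)]
  exact lintegral_congr fun p => enorm_rootWeight_mul_sq hn s t p _

lemma memLp_weightedTS (hn : 2 ≤ n) (s t : ℝ) (ht : -(n : ℝ) / 2 < t) (φ : 𝓢(E n, ℂ)) :
    MemLp (weightedTS s t φ) 2 (measureTS n) := by
  refine ⟨(measurable_weightedTS s t φ).aestronglyMeasurable, ?_⟩
  rw [eLpNorm_lt_top_iff_lintegral_rpow_enorm_lt_top two_ne_zero ENNReal.ofNat_ne_top]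
  have h := sum_lintegral_weightedTS hn s t ht fun _ => φ
  have h1 := Finset.single_le_sum (s := Finset.univ) (f := fun _ : Fin n =>
    ∫⁻ p, ‖weightedTS s t φ p‖ₑ ^ 2 ∂measureTS n) (fun _ _ => zero_le) (Finset.mem_univ ⟨0, by omega⟩)
  simp only [ENNReal.toReal_ofNat, ENNReal.rpow_ofNat]
  exact (h1.trans h.le).trans_lt ENNReal.ofReal_lt_top

lemma ofReal_norm_sq_Lp {α : Type*} {m : MeasurableSpace α} {μ : Measure α} (h : Lp ℂ 2 μ) :
    ENNReal.ofReal (‖h‖ ^ 2) = ∫⁻ p, ‖h p‖ₑ ^ 2 ∂μ := by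
  rw [ENNReal.ofReal_pow (norm_nonneg _), Lp.norm_def, ENNReal.ofReal_toReal (Lp.eLpNorm_ne_top h)]
  have := eLpNorm_nnreal_pow_eq_lintegral (μ := μ) (f := h) (p := 2) two_ne_zero
  simpa using this

/-- The isometric embedding of the Schwartz fields. -/
def embedTS (hn : 2 ≤ n) (s t : ℝ) (ht : -(n : ℝ) / 2 < t) :
    SchwartzField n s t ht →+ PiLp 2 (fun _ : Fin n => Lp ℂ 2 (measureTS n)) :=
  AddMonoidHom.mk' (fun f => WithLp.toLp 2 fun i => (memLp_weightedTS hn s t ht (f.comp i)).toLp _)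
    fun f g => by
      ext1 i
      refine Eq.trans ?_ (MemLp.toLp_add (memLp_weightedTS hn s t ht (f.comp i))
        (memLp_weightedTS hn s t ht (g.comp i)))
      refine MemLp.toLp_congr (memLp_weightedTS hn s t ht ((f + g).comp i)) _
        (Eventually.of_forall fun y => ?_)
      change _ * fourierE (⇑(f.comp i + g.comp i)) y.1 = _
      rw [fourierE_add, mul_add]
      rfl

lemma embedTS_coeFn (hn : 2 ≤ n) {s t : ℝ} {ht : -(n : ℝ) / 2 < t} (f : SchwartzField n s t ht)
    (i : Fin n) : embedTS hn s t ht f i =ᵐ[measureTS n] weightedTS s t (f.comp i) :=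
  (memLp_weightedTS hn s t ht (f.comp i)).coeFn_toLp

lemma ofReal_norm_sq_PiLp (h : PiLp 2 (fun _ : Fin n => Lp ℂ 2 (measureTS n))) :
    ENNReal.ofReal (‖h‖ ^ 2) = ∑ i, ∫⁻ p, ‖h i p‖ₑ ^ 2 ∂measureTS n := by
  rw [PiLp.norm_sq_eq_of_L2, ENNReal.ofReal_sum_of_nonneg fun i _ => by positivity]
  exact Finset.sum_congr rfl fun i _ => ofReal_norm_sq_Lp _

/-- This is `ofReal_sobolevSq` restated: `rootWeight` absorbs both `a n` and the shifted weight. -/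
lemma isometry_embedTS (hn : 2 ≤ n) (s t : ℝ) (ht : -(n : ℝ) / 2 < t) :
    Isometry (embedTS hn s t ht) := by
  refine AddMonoidHomClass.isometry_of_norm _ fun f => ?_
  rw [← sq_eq_sq₀ (norm_nonneg _) (norm_nonneg _), ← ENNReal.ofReal_eq_ofReal_iff (by positivity)
    (by positivity), ofReal_norm_sq_PiLp, norm_sq_eq, ← sum_lintegral_weightedTS hn s t ht]
  refine Finset.sum_congr rfl fun i _ => lintegral_congr_ae ?_
  filter_upwards [embedTS_coeFn hn f i] with p hp
  rw [hp]

/-- The isometric embedding of `H^s_t`. -/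
def embedH (hn : 2 ≤ n) {s t : ℝ} {ht : -(n : ℝ) / 2 < t} (f : H n s t ht) :
    PiLp 2 (fun _ : Fin n => Lp ℂ 2 (measureTS n)) :=
  UniformSpace.Completion.extension (embedTS hn s t ht) f

lemma norm_embedH (hn : 2 ≤ n) {s t : ℝ} {ht : -(n : ℝ) / 2 < t} (f : H n s t ht) :
    ‖embedH hn f‖ = ‖f‖ := by
  have hi := isometry_embedTS hn s t ht
  have h0 : embedH hn (0 : H n s t ht) = 0 := by
    rw [embedH, ← UniformSpace.Completion.coe_zero,
      UniformSpace.Completion.extension_coe hi.uniformContinuous, map_zero]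
  rw [← dist_zero_right, ← dist_zero_right, ← h0]
  exact hi.completion_extension.dist_eq f 0

lemma tendsto_embedTS (hn : 2 ≤ n) {s t : ℝ} {ht : -(n : ℝ) / 2 < t} (f : H n s t ht) :
    Tendsto (embedTS hn s t ht) (comap (fun u : SchwartzField n s t ht => (u : H n s t ht)) (𝓝 f))
      (𝓝 (embedH hn f)) := by
  have hi := isometry_embedTS hn s t ht
  have h1 : Tendsto (embedH hn) (𝓝 f) (𝓝 (embedH hn f)) :=
    (UniformSpace.Completion.continuous_extension (f := embedTS hn s t ht)).tendsto f
  refine (h1.comp tendsto_comap).congr fun u => ?_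
  exact UniformSpace.Completion.extension_coe hi.uniformContinuous u

/-- The Fourier transform of an element of `H^s_t`, as a function on `TSⁿ⁻¹`. -/
def fourierH (hn : 2 ≤ n) {s t : ℝ} {ht : -(n : ℝ) / 2 < t} (f : H n s t ht) (i : Fin n)
    (p : E n × E n) : ℂ :=
  (rootWeight s t p : ℂ)⁻¹ * embedH hn f i p

lemma measurable_fourierH (hn : 2 ≤ n) {s t : ℝ} {ht : -(n : ℝ) / 2 < t} (f : H n s t ht)
    (i : Fin n) : Measurable (fourierH hn f i) :=
  (Complex.measurable_ofReal.comp (measurable_rootWeight s t)).inv.mul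
    (Lp.stronglyMeasurable _).measurable

lemma ofReal_norm_sq_H (hn : 2 ≤ n) {s t : ℝ} {ht : -(n : ℝ) / 2 < t} (f : H n s t ht) :
    ENNReal.ofReal (‖f‖ ^ 2) = ENNReal.ofReal (a n) * ∑ i, ∫⁻ p, ENNReal.ofReal
      (weight (s + 1 / 2) (t + 1 / 2) p.1 * ‖fourierH hn f i p‖ ^ 2) ∂measureTS n := by
  rw [← norm_embedH hn f, ofReal_norm_sq_PiLp, Finset.mul_sum]
  refine Finset.sum_congr rfl fun i _ => ?_
  rw [← lintegral_const_mul' _ _ (by finiteness)]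
  refine lintegral_congr_ae ?_
  filter_upwards [ae_measureTS_ne_zero hn] with p hp
  have h0 : (rootWeight s t p : ℂ) ≠ 0 := by exact_mod_cast (rootWeight_pos hn s t hp).ne'
  rw [← enorm_rootWeight_mul_sq hn s t p, fourierH, mul_inv_cancel_left₀ h0]

lemma lintegral_fourierH_ne_top (hn : 2 ≤ n) {s t : ℝ} {ht : -(n : ℝ) / 2 < t} (f : H n s t ht)
    (i : Fin n) : ∫⁻ p, ENNReal.ofReal
      (weight (s + 1 / 2) (t + 1 / 2) p.1 * ‖fourierH hn f i p‖ ^ 2) ∂measureTS n ≠ ⊤ := by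
  intro h
  have h1 := ofReal_norm_sq_H hn f
  rw [ENNReal.sum_eq_top.2 ⟨i, Finset.mem_univ i, h⟩,
    ENNReal.mul_top (ENNReal.ofReal_pos.2 (a_pos hn)).ne'] at h1
  exact ENNReal.ofReal_ne_top h1

/-- The pairing is an `L²` inner product of the embedded field with `χ / rootWeight`. That function
is continuous with compact support, because `χ` is supported where `rootWeight` is positive and
continuous. -/
lemma tendsto_pairing_fourier (hn : 2 ≤ n) {s t : ℝ} {ht : -(n : ℝ) / 2 < t} (f : H n s t ht)
    (i : Fin n) {χ : E n × E n → ℝ} (hχ : IsTest χ) :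
    Tendsto (fun u : SchwartzField n s t ht =>
        ∫ p, (χ p : ℂ) * fourierE (u.comp i) p.1 ∂measureTS n)
      (comap (fun u : SchwartzField n s t ht => (u : H n s t ht)) (𝓝 f))
      (𝓝 (∫ p, (χ p : ℂ) * fourierH hn f i p ∂measureTS n)) := by
  let c : E n × E n → ℂ := fun p => ((χ p * (rootWeight s t p)⁻¹ : ℝ) : ℂ)
  have hcc : Continuous fun p => χ p * (rootWeight s t p)⁻¹ := by
    refine continuous_of_tsupport fun p hp => ?_
    have hp1 := hχ.away p (tsupport_mul_subset_left hp)
    exact hχ.smooth.continuous.continuousAt.mul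
      ((continuousAt_rootWeight s t hp1).inv₀ (rootWeight_pos hn s t hp1).ne')
  have hcs : HasCompactSupport c := by
    have h1 : HasCompactSupport fun p => χ p * (rootWeight s t p)⁻¹ := hχ.compact.mul_right
    exact h1.comp_left (g := fun r : ℝ => (r : ℂ)) Complex.ofReal_zero
  have hc : MemLp c 2 (measureTS n) :=
    (Complex.continuous_ofReal.comp hcc).memLp_of_hasCompactSupport hcs
  have key : ∀ h : Lp ℂ 2 (measureTS n), inner ℂ (hc.toLp c) h =
      ∫ p, (χ p : ℂ) * ((rootWeight s t p : ℂ)⁻¹ * h p) ∂measureTS n := by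
    intro h
    rw [L2.inner_def]
    refine integral_congr_ae ?_
    filter_upwards [hc.coeFn_toLp] with p hp
    rw [hp, RCLike.inner_apply]
    simp only [c, Complex.conj_ofReal]
    push_cast
    ring
  have h1 : Tendsto (fun u : SchwartzField n s t ht =>
      inner ℂ (hc.toLp c) (embedTS hn s t ht u i))
      (comap (fun u : SchwartzField n s t ht => (u : H n s t ht)) (𝓝 f))
      (𝓝 (inner ℂ (hc.toLp c) (embedH hn f i))) := by
    have h2 : Continuous fun h : PiLp 2 (fun _ : Fin n => Lp ℂ 2 (measureTS n)) =>
        inner ℂ (hc.toLp c) (h i) := by fun_prop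
    exact (h2.tendsto _).comp (tendsto_embedTS hn f)
  rw [key] at h1
  refine h1.congr fun u => ?_
  rw [key]
  refine integral_congr_ae ?_
  filter_upwards [embedTS_coeFn hn u i, ae_measureTS_ne_zero hn] with p hp hp'
  have h0 : (rootWeight s t p : ℂ) ≠ 0 := by exact_mod_cast (rootWeight_pos hn s t hp').ne'
  rw [hp, weightedTS, inv_mul_cancel_left₀ h0]

/-! ### The estimate for elements of `H^s_t` -/

/-- Finite norms make `g`, `g₀`, `g₁` locally integrable off the zero section. The inversion formula
and the orthogonality to `ξ` hold for Schwartz fields, pass to the limit in pairings, and thus hold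
almost everywhere. -/
lemma norm_sq_le_of_represents (hn : 2 ≤ n) {s t : ℝ} {ht : -(n : ℝ) / 2 < t} (f : H n s t ht)
    {g : Fin n → E n × E n → ℂ} {g₀ g₁ : E n × E n → ℂ}
    (hg : ∀ i, Measurable (g i)) (hg₀ : Measurable g₀) (hg₁ : Measurable g₁)
    (hgf : ∀ i, normSqTS (s + 1 / 2) (t + 1 / 2) (g i) ≠ ⊤)
    (hg₀f : normSqTS (s + 1 / 2) (t + 1 / 2) g₀ ≠ ⊤)
    (hg₁f : normSqTS (s + 3 / 2) (t + 3 / 2) g₁ ≠ ⊤)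
    (hr : ∀ i, RepresentsFourier (fun u => Xi i (momentRay 0 u)) f (g i))
    (hr₀ : RepresentsFourier (momentRay 0) f g₀) (hr₁ : RepresentsFourier (momentRay 1) f g₁) :
    ENNReal.ofReal (‖f‖ ^ 2) ≤ ENNReal.ofReal (2 * a n) *
      ((∑ i, normSqTS (s + 1 / 2) (t + 1 / 2) (g i)) +
        normSqTS (s + 1 / 2) (t + 1 / 2) g₀ + normSqTS (s + 3 / 2) (t + 3 / 2) g₁) := by
  have hpi : ENNReal.ofReal (2 * Real.pi)⁻¹ ≠ 0 :=
    (ENNReal.ofReal_pos.2 (by positivity)).ne'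
  have hloc : ∀ {s' t' : ℝ} {g : E n × E n → ℂ}, Measurable g → normSqTS s' t' g ≠ ⊤ →
      LocallyIntegrableOn g (awayZero n) (measureTS n) := fun {s' t' g} hm hf => by
    rw [normSqTS_eq _ _ hm] at hf
    exact locallyIntegrableOn_of_weight s' t' hm fun h => hf (by rw [h, ENNReal.mul_top hpi])
  have hl := fun i => hloc (hg i) (hgf i)
  have hl₀ := hloc hg₀ hg₀f
  have hl₁ := hloc hg₁ hg₁f
  have hlF := fun i => locallyIntegrableOn_of_weight _ _ (measurable_fourierH hn f i)
    (lintegral_fourierH_ne_top hn f i)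
  -- Density of the Schwartz fields makes the approximating filter nontrivial, as uniqueness of
  -- limits requires.
  have := UniformSpace.Completion.isDenseInducing_coe.comap_nhds_neBot f
  have hc₁ : ∀ i : Fin n, Continuous fun p : E n × E n => ((p.1 i : ℝ) : ℂ) := fun i => by fun_prop
  have hc₂ : ∀ i : Fin n, Continuous fun p : E n × E n => ((p.2 i : ℝ) : ℂ) := fun i => by fun_prop
  have htend : ∀ {A : (Fin n → 𝓢(E n, ℂ)) → E n × E n → ℂ} {g : E n × E n → ℂ}
      {Φ : (Fin n → 𝓢(E n, ℂ)) → E n × E n → ℂ}, Measurable g →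
      LocallyIntegrableOn g (awayZero n) (measureTS n) → RepresentsFourier A f g →
      (∀ u, Continuous (Φ u)) →
      (∀ u y ξ, ‖ξ‖ = 1 → ⟪y, ξ⟫_ℝ = 0 → fourierTS (A u) (y, ξ) = Φ u (y, ξ)) →
      ∀ χ, IsTest χ → Tendsto (fun u : SchwartzField n s t ht =>
        ∫ p, (χ p : ℂ) * Φ u.comp p ∂measureTS n)
        (comap (fun u : SchwartzField n s t ht => (u : H n s t ht)) (𝓝 f))
        (𝓝 (∫ p, (χ p : ℂ) * g p ∂measureTS n)) := by
    intro A g Φ hm hl hr hΦ hA χ hχ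
    have h := hr χ hχ
    rw [pairTS_eq hχ hm hl] at h
    refine h.congr fun u => ?_
    rw [pairTS_congr χ (hA u.comp), pairTS_eq hχ (hΦ u.comp).measurable
      (Continuous.locallyIntegrableOn_awayZero (hΦ u.comp))]
  have ht₀ := htend hg₀ hl₀ hr₀ continuous_rayFourier₀ fun u y ξ hξ hy =>
    fourierTS_momentRay_zero u hξ hy
  have ht₁ := htend hg₁ hl₁ hr₁ continuous_rayFourier₁ fun u y ξ hξ hy =>
    fourierTS_momentRay_one u hξ hy
  have hti := fun i => htend (hg i) (hl i) (hr i) (continuous_xiFourier i) fun u y ξ hξ hy =>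
    fourierTS_Xi_momentRay_zero i u hξ hy
  have h1 : ∀ᵐ p ∂measureTS n, ∀ i, (√(2 * Real.pi) : ℂ) * fourierH hn f i p =
      g i p + (p.2 i : ℝ) * g₀ p - Complex.I * (p.1 i : ℝ) * g₁ p := by
    refine ae_all_iff.2 fun i => ?_
    have hl' : LocallyIntegrableOn (fun p => (√(2 * Real.pi) : ℂ) * fourierH hn f i p -
        (g i p + (p.2 i : ℝ) * g₀ p - Complex.I * (p.1 i : ℝ) * g₁ p))
        (awayZero n) (measureTS n) :=
      ((hlF i).continuousOn_mul continuousOn_const isOpen_awayZero.isLocallyClosed).sub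
        (((hl i).add (hl₀.continuousOn_mul (hc₂ i).continuousOn isOpen_awayZero.isLocallyClosed)).sub
          (hl₁.continuousOn_mul (continuousOn_const.mul (hc₁ i).continuousOn)
            isOpen_awayZero.isLocallyClosed))
    refine (ae_eq_zero_of_pairing hn hl' fun χ hχ => ?_).mono fun p hp => sub_eq_zero.1 hp
    rw [integral_test_mul_sub i _ hχ (hlF i) (hl i) hl₀ hl₁]
    refine tendsto_nhds_unique (((tendsto_pairing_fourier hn f i hχ).const_mul _).sub
      (((hti i χ hχ).add (ht₀ _ (hχ.mul (contDiff_coord_snd i)))).sub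
        ((ht₁ _ (hχ.mul (contDiff_coord_fst i))).const_mul _)))
      -- The same combination of pairings is identically zero along the approximating Schwartz
      -- fields.
      (tendsto_const_nhds.congr fun u => ?_)
    have hu : Continuous fun p : E n × E n => fourierE (u.comp i) p.1 :=
      (continuous_fourierE (u.comp i)).comp continuous_fst
    rw [← integral_test_mul_sub i _ hχ (Continuous.locallyIntegrableOn_awayZero hu)
      (Continuous.locallyIntegrableOn_awayZero (continuous_xiFourier i u.comp))
      (Continuous.locallyIntegrableOn_awayZero (continuous_rayFourier₀ u.comp))
      (Continuous.locallyIntegrableOn_awayZero (continuous_rayFourier₁ u.comp))]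
    refine (integral_eq_zero_of_ae ?_).symm
    refine Eventually.of_forall fun p => ?_
    beta_reduce
    rw [fourierE_eq_xiFourier i u.comp p, sub_self, mul_zero, Pi.zero_apply]
  have h2 : ∀ᵐ p ∂measureTS n, ∑ i, ((p.2 i : ℝ) : ℂ) * g i p = 0 := by
    have hl' : ∀ i, LocallyIntegrableOn (fun p => ((p.2 i : ℝ) : ℂ) * g i p) (awayZero n)
        (measureTS n) := fun i =>
      (hl i).continuousOn_mul (hc₂ i).continuousOn isOpen_awayZero.isLocallyClosed
    have hsum : LocallyIntegrableOn (fun p => ∑ i, ((p.2 i : ℝ) : ℂ) * g i p) (awayZero n)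
        (measureTS n) := by
      have : ∀ S : Finset (Fin n), LocallyIntegrableOn
          (fun p => ∑ i ∈ S, ((p.2 i : ℝ) : ℂ) * g i p) (awayZero n) (measureTS n) := by
        intro S
        induction S using Finset.induction_on with
        | empty => simpa using locallyIntegrableOn_zero
        | insert i S hi ih =>
          simp_rw [Finset.sum_insert hi]
          exact (hl' i).add ih
      exact this _
    have hint : ∀ {χ : E n × E n → ℝ}, IsTest χ → ∀ {G : Fin n → E n × E n → ℂ},
        (∀ i, LocallyIntegrableOn (G i) (awayZero n) (measureTS n)) →
        ∫ p, (χ p : ℂ) * ∑ i, ((p.2 i : ℝ) : ℂ) * G i p ∂measureTS n =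
          ∑ i, ∫ p, ((χ p * p.2 i : ℝ) : ℂ) * G i p ∂measureTS n := by
      intro χ hχ G hG
      rw [← integral_finsetSum _ fun i _ =>
        (hχ.mul (contDiff_coord_snd i)).integrable_mul (hG i)]
      refine integral_congr_ae (Eventually.of_forall fun p => ?_)
      simp only [Finset.mul_sum]
      refine Finset.sum_congr rfl fun i _ => ?_
      push_cast
      ring
    refine ae_eq_zero_of_pairing hn hsum fun χ hχ => ?_
    rw [hint hχ hl]
    refine tendsto_nhds_unique (tendsto_finsetSum _ fun i _ =>
      hti i _ (hχ.mul (contDiff_coord_snd i))) (tendsto_const_nhds.congr fun u => ?_)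
    rw [← hint hχ fun i => Continuous.locallyIntegrableOn_awayZero (continuous_xiFourier i u.comp)]
    refine (integral_eq_zero_of_ae ?_).symm
    filter_upwards [ae_measureTS] with p hp
    rw [sum_xiFourier u.comp hp.1 hp.2, mul_zero, Pi.zero_apply]
  rw [ofReal_norm_sq_H hn f, mul_comm 2, ENNReal.ofReal_mul (a_pos hn).le, mul_assoc,
    ENNReal.ofReal_ofNat]
  exact mul_le_mul_right (sum_lintegral_le hn s t (measurable_fourierH hn f) hg hg₀ hg₁ h1 h2) _

/-- Near-minimizers suffice for the estimate, so neither attainment of the infimum nor uniqueness of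
the representing function is needed. -/
lemma exists_normSqTS_le_extNormSq {s t : ℝ} {ht : -(n : ℝ) / 2 < t} {s' t' : ℝ}
    {A : (Fin n → 𝓢(E n, ℂ)) → E n × E n → ℂ} {f : H n s t ht} (h : extNormSq s' t' A f ≠ ⊤)
    {ε : ℝ≥0∞} (hε : ε ≠ 0) : ∃ g, Measurable g ∧ RepresentsFourier A f g ∧
      normSqTS s' t' g < extNormSq s' t' A f + ε := by
  have h1 : extNormSq s' t' A f < extNormSq s' t' A f + ε := ENNReal.lt_add_right h hε
  conv_lhs at h1 => rw [extNormSq]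
  simp only [iInf_lt_iff, exists_prop] at h1
  exact h1

theorem norm_sq_le (hn : 2 ≤ n) {s t : ℝ} {ht : -(n : ℝ) / 2 < t} (f : H n s t ht) :
    ENNReal.ofReal (‖f‖ ^ 2) ≤ ENNReal.ofReal (2 * a n) *
      ((∑ i, extNormSq (s + 1 / 2) (t + 1 / 2) (fun u => Xi i (momentRay 0 u)) f)
        + extNormSq (s + 1 / 2) (t + 1 / 2) (momentRay 0) f
        + extNormSq (s + 3 / 2) (t + 3 / 2) (momentRay 1) f) := by
  have ha : 0 < 2 * a n := mul_pos two_pos (a_pos hn)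
  by_cases htop : (∑ i, extNormSq (s + 1 / 2) (t + 1 / 2) (fun u => Xi i (momentRay 0 u)) f)
        + extNormSq (s + 1 / 2) (t + 1 / 2) (momentRay 0) f
        + extNormSq (s + 3 / 2) (t + 3 / 2) (momentRay 1) f = ⊤
  · rw [htop, ENNReal.mul_top (ENNReal.ofReal_pos.2 ha).ne']
    exact le_top
  simp only [ENNReal.add_eq_top, not_or, ENNReal.sum_eq_top, not_exists, not_and, Finset.mem_univ,
    true_implies] at htop
  obtain ⟨⟨hX, hX₀⟩, hX₁⟩ := htop
  refine ENNReal.le_of_forall_pos_le_add fun δ hδ _ => ?_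
  -- There are `n + 2` norms on the right, each approximated up to `ε` and multiplied by `2 * a n`,
  -- so the total error is exactly `δ`.
  set ε : ℝ≥0∞ := ENNReal.ofReal (δ / (2 * a n * (n + 2))) with hε
  have hε0 : ε ≠ 0 := (ENNReal.ofReal_pos.2 (by positivity)).ne'
  choose g hgm hgr hgl using fun i => exists_normSqTS_le_extNormSq (hX i) hε0
  obtain ⟨g₀, hgm₀, hgr₀, hgl₀⟩ := exists_normSqTS_le_extNormSq hX₀ hε0
  obtain ⟨g₁, hgm₁, hgr₁, hgl₁⟩ := exists_normSqTS_le_extNormSq hX₁ hε0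
  refine (norm_sq_le_of_represents hn f hgm hgm₀ hgm₁ (fun i => (hgl i).ne_top) hgl₀.ne_top
    hgl₁.ne_top hgr hgr₀ hgr₁).trans ?_
  calc _ ≤ ENNReal.ofReal (2 * a n) *
      ((∑ i, (extNormSq (s + 1 / 2) (t + 1 / 2) (fun u => Xi i (momentRay 0 u)) f + ε))
        + (extNormSq (s + 1 / 2) (t + 1 / 2) (momentRay 0) f + ε)
        + (extNormSq (s + 3 / 2) (t + 3 / 2) (momentRay 1) f + ε)) :=
        mul_le_mul_right (add_le_add (add_le_add (Finset.sum_le_sum fun i _ => (hgl i).le) hgl₀.le)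
          hgl₁.le) _
    _ = ENNReal.ofReal (2 * a n) *
      ((∑ i, extNormSq (s + 1 / 2) (t + 1 / 2) (fun u => Xi i (momentRay 0 u)) f)
        + extNormSq (s + 1 / 2) (t + 1 / 2) (momentRay 0) f
        + extNormSq (s + 3 / 2) (t + 3 / 2) (momentRay 1) f) +
          ENNReal.ofReal (2 * a n) * ((n + 2) * ε) := by
        rw [Finset.sum_add_distrib, Finset.sum_const, Finset.card_univ, Fintype.card_fin,
          nsmul_eq_mul]
        ring
    _ = _ := by
        congr 1
        rw [hε, show ((n : ℝ≥0∞) + 2) = ENNReal.ofReal (n + 2) by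
          rw [ENNReal.ofReal_add (by positivity) two_pos.le]; simp,
          ← ENNReal.ofReal_mul (by positivity), ← ENNReal.ofReal_mul ha.le,
          ← ENNReal.ofReal_coe_nnreal]
        congr 1
        have := (a_pos hn).ne'
        field_simp

end MomentumRay

end

theorem mainTheorem6 (n : ℕ) (hn : 2 ≤ n) (s t : ℝ) (ht : -(n : ℝ) / 2 < t) :
    (∀ f : Fin n → 𝓢(MomentumRay.E n, ℂ),
      ENNReal.ofReal (MomentumRay.sobolevSq s t f) ≤ ENNReal.ofReal (2 * MomentumRay.a n) *
        ((∑ i, MomentumRay.normSqTS (s + 1 / 2) (t + 1 / 2)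
            (MomentumRay.fourierTS (MomentumRay.Xi i (MomentumRay.momentRay 0 f))))
          + MomentumRay.normSqTS (s + 1 / 2) (t + 1 / 2)
            (MomentumRay.fourierTS (MomentumRay.momentRay 0 f))
          + MomentumRay.normSqTS (s + 3 / 2) (t + 3 / 2)
            (MomentumRay.fourierTS (MomentumRay.momentRay 1 f)))) ∧
    (∀ f : MomentumRay.H n s t ht,
      ENNReal.ofReal (‖f‖ ^ 2) ≤ ENNReal.ofReal (2 * MomentumRay.a n) *
        ((∑ i, MomentumRay.extNormSq (s + 1 / 2) (t + 1 / 2)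
            (fun u => MomentumRay.Xi i (MomentumRay.momentRay 0 u)) f)
          + MomentumRay.extNormSq (s + 1 / 2) (t + 1 / 2) (MomentumRay.momentRay 0) f
          + MomentumRay.extNormSq (s + 3 / 2) (t + 3 / 2) (MomentumRay.momentRay 1) f)) := by
  exact ⟨fun f => MomentumRay.sobolevSq_le hn s t ht f, fun f => MomentumRay.norm_sq_le hn f⟩
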